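/- Fix $p_0,p\ge 0$. For every sample size $n$ let $X_0=X_0^{(n)}\in\mathbb R^{n\times p_0}$ and $X=X^{(n)}\in\mathbb R^{n\times p}$ be design matrices such that, for all large $n$, the columns of $(X_0, X)$ are linearly independent and $X_0'X=0$. For $\gamma\subseteq\{1,\dots,p\}$ let $X_\gamma$ be the matrix formed by the columns of $X$ with index in $\gamma$, and let $\mathcal M_\gamma$ be the model $Y\sim N_n(X_0\beta_0+X_\gamma\beta_\gamma,\sigma^2I_n)$; $\gamma=\emptyset$ is the null model, and $\mathcal M_\gamma$ nests $\mathcal M_\delta$ if $\delta\subseteq\gamma$. For a symmetric positive definite $W$ put $$m_{\gamma,W}(y)=\int_{\mathbb R^{p_0}}\int_{\mathbb R^{|\gamma|}}\int_0^\infty N_n(y\mid X_0\beta_0+X_\gamma\beta,\sigma^2I_n)\,N_{|\gamma|}(\beta\mid 0,\sigma^2W)\,\frac1{\sigma^2}\,d\sigma^2\,d\beta\,d\beta_0 ,$$ let the restricted type II maximum likelihood (type II ML) matrix of $\mathcal M_\gamma$ be $$\widehat W_\gamma(y)\in\operatorname{arg\,max}\{m_{\gamma,W}(y): W\succeq n(X_\gamma'X_\gamma)^{-1}\},$$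 and let $m_\gamma(y)=m_{\gamma,\widehat W_\gamma(y)}(y)$. (Where no maximizer exists, put $\widehat W_\gamma(y)=n(X_\gamma'X_\gamma)^{-1}$.) Given prior model probabilities $\pi(\gamma)\ge0$ with $\sum_\gamma\pi(\gamma)=1$, not depending on $n$, the posterior probability of $\mathcal M_\gamma$ under the type II ML prior is $$\mathbb P(\mathcal M_\gamma\mid y)=\frac{\pi(\gamma)m_\gamma(y)}{\sum_\delta\pi(\delta)m_\delta(y)} .$$ Let the true model be $\mathcal M_*=\mathcal M_{\gamma_*}$ with $\pi(\gamma_*)>0$; that is, for every $n$ the data satisfy $Y=Y^{(n)}\sim N_n(X_0\beta_0+X_*\beta_*,\sigma^2I_n)$, where $X_*=X_{\gamma_*}$, with fixed $\beta_*\in\mathbb R^{|\gamma_*|}$ and $\sigma^2>0$ (the common coefficient vector $\beta_0$ may depend on $n$). The joint distribution of the data at different sample sizes is arbitrary. Write $\mathsf P_{X_j}=X_j(X_j'X_j)^{-1}X_j'$ and assume that for every model $\mathcal M_j$ that does not nest $\mathcal M_*$ there is $b_j\in(0,\infty)$ with $$\lim_{n\to\infty}\frac{\beta_*'X_*'(I_n-\mathsf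 P_{X_j})X_*\beta_*}{n}=b_j .$$ Then, for all large $n$, with probability one the maximum defining $\widehat W_\gamma(Y)$ is attained for every $\gamma$, and $$\mathbb P(\mathcal M_*\mid Y)\to 1\quad\text{in probability as } n\to\infty .$$ -/

import Mathlib

open MeasureTheory ProbabilityTheory Filter Topology
open scoped ENNReal NNReal Matrix

noncomputable section

namespace TypeIIML

/-- The density `N(y | m, S)` of the multivariate normal distribution with mean `m` and
positive definite covariance matrix `S`. -/
def normalDensity {ι : Type*} [Fintype ι] [DecidableEq ι]
    (y m : ι → ℝ) (S : Matrix ι ι ℝ) : ℝ :=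
  (Real.sqrt ((2 * Real.pi) ^ Fintype.card ι * S.det))⁻¹ *
    Real.exp (-(1 / 2) * ((y - m) ⬝ᵥ (S⁻¹ *ᵥ (y - m))))

/-- The marginal likelihood `m_W(y)` of the normal linear model
`y = X₀ β₀ + X β + ε`, `ε ∼ N(0, σ² I)`, under the prior `π(β₀, σ²) ∝ 1 / σ²`,
`β | σ² ∼ N(0, σ² W)`. The innermost variable `v` is `σ²`. -/
def marginalLikelihood {n p₀ : ℕ} {κ : Type*} [Fintype κ] [DecidableEq κ]
    (X₀ : Matrix (Fin n) (Fin p₀) ℝ) (X : Matrix (Fin n) κ ℝ) (W : Matrix κ κ ℝ)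
    (y : Fin n → ℝ) : ℝ≥0∞ :=
  ∫⁻ β₀ : Fin p₀ → ℝ, ∫⁻ β : κ → ℝ, ∫⁻ v in Set.Ioi (0 : ℝ),
    ENNReal.ofReal
      (normalDensity y (X₀ *ᵥ β₀ + X *ᵥ β) (v • (1 : Matrix (Fin n) (Fin n) ℝ)) *
        normalDensity β 0 (v • W) * (1 / v))

/-- The unit-information lower bound `n (XᵀX)⁻¹` for the prior covariance matrix. -/
def lowerBound {n : ℕ} {κ : Type*} [Fintype κ] [DecidableEq κ]
    (X : Matrix (Fin n) κ ℝ) : Matrix κ κ ℝ :=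
  (n : ℝ) • (Xᵀ * X)⁻¹

/-- `W` maximizes the marginal likelihood over all `W ⪰ n (XᵀX)⁻¹`. -/
def IsTypeIIMLCov {n p₀ : ℕ} {κ : Type*} [Fintype κ] [DecidableEq κ]
    (X₀ : Matrix (Fin n) (Fin p₀) ℝ) (X : Matrix (Fin n) κ ℝ) (y : Fin n → ℝ)
    (W : Matrix κ κ ℝ) : Prop :=
  (W - lowerBound X).PosSemidef ∧
    ∀ W' : Matrix κ κ ℝ, (W' - lowerBound X).PosSemidef →
      marginalLikelihood X₀ X W' y ≤ marginalLikelihood X₀ X W y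

open Classical in
/-- The restricted type II maximum likelihood matrix `Ŵ = argmax_{W ⪰ n (XᵀX)⁻¹} m_W(y)`.
If there is no maximizer, the value is the (irrelevant) lower bound. -/
def typeIIMLCov {n p₀ : ℕ} {κ : Type*} [Fintype κ] [DecidableEq κ]
    (X₀ : Matrix (Fin n) (Fin p₀) ℝ) (X : Matrix (Fin n) κ ℝ) (y : Fin n → ℝ) :
    Matrix κ κ ℝ :=
  if h : ∃ W, IsTypeIIMLCov X₀ X y W then h.choose else lowerBound X

/-- A model is a set `γ` of columns of `X`; its design matrix consists of these columns. -/
def modelDesign {n p : ℕ} (X : Matrix (Fin n) (Fin p) ℝ) (γ : Finset (Fin p)) :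
    Matrix (Fin n) γ ℝ :=
  X.submatrix id Subtype.val

/-- The marginal likelihood of the model `γ` under its own type II ML prior. -/
def modelMarginal {n p₀ p : ℕ} (X₀ : Matrix (Fin n) (Fin p₀) ℝ)
    (X : Matrix (Fin n) (Fin p) ℝ) (γ : Finset (Fin p)) (y : Fin n → ℝ) : ℝ≥0∞ :=
  marginalLikelihood X₀ (modelDesign X γ) (typeIIMLCov X₀ (modelDesign X γ) y) y

/-- The posterior probability of the model `γ`, given the data `y` and prior model
probabilities `prior`. -/
def posteriorProb {n p₀ p : ℕ} (prior : Finset (Fin p) → ℝ≥0)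
    (X₀ : Matrix (Fin n) (Fin p₀) ℝ) (X : Matrix (Fin n) (Fin p) ℝ)
    (γ : Finset (Fin p)) (y : Fin n → ℝ) : ℝ :=
  ((prior γ * modelMarginal X₀ X γ y) /
    ∑ δ : Finset (Fin p), prior δ * modelMarginal X₀ X δ y).toReal

/-- The projection matrix `P_X = X (XᵀX)⁻¹ Xᵀ`. -/
def proj {n : ℕ} {κ : Type*} [Fintype κ] [DecidableEq κ] (X : Matrix (Fin n) κ ℝ) :
    Matrix (Fin n) (Fin n) ℝ :=
  X * (Xᵀ * X)⁻¹ * Xᵀ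

end TypeIIML

end

/-!
Integrating out `β₀`, `β` and `σ²` (`marginalLikelihood_eq`) leaves, up to a constant common to
all models, `(det W · det (XᵀX + W⁻¹))^{-1/2} · S_W^{-ν/2}`, where `ν = n - p₀` and `S_W` is the
minimum of the penalised sum of squares. In coordinates in which the columns of `X` are
orthonormal, with `A` the transformed prior covariance and `u` the regression coefficients, this
is `det (1 + A)^{-1/2} · (T + uᵀ (1 + A)⁻¹ u)^{-ν/2}`, where `T` is the residual sum of squares,
and the constraint `W ⪰ n (XᵀX)⁻¹` becomes `A ⪰ n I` (`marginalLikelihood_whitened`).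

*Existence.* If `T > 0`, this function is continuous on the closed set `A ⪰ n I` and tends to zero
at infinity, because the determinant bounds every eigenvalue of `1 + A`; so the maximum is
attained (`exists_isMaxOn_whitenedEvidence`). For `n > p₀ + p` the event `T = 0` forces a nonzero
linear functional of the Gaussian data to take a fixed value, which has probability zero
(`ae_rss_pos`).

*Consistency.* On `A ⪰ n I` the determinant is at least `(1 + n)^k`, with equality at `A = n I`.
Hence the restricted maximum lies between `(1 + n)^{-k/2} (T + |u|² / (1 + n))^{-ν/2}` and
`(1 + n)^{-k/2} T^{-ν/2}` (`modelMarginal_bounds`); these bounds need no maximizer, since the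
fallback value of `Ŵ` is the lower bound itself. If `γ_*` is nonempty, the separation of the empty
model from the truth gives `|X_* β_*|² = O(n)` (`exists_mean_sq_le`), so for the true model the
two bounds differ by a bounded term in the sum of squares. A larger model that nests the true one
reduces `T` by a bounded amount only, so that its likelihood ratio is bounded and the factor
`(1 + n)^{-1/2}` for the extra parameter decides (`eventually_evidence_le_of_nested`). A model
that does not nest the true one has a sum of squares larger by a multiple of `n`, so that its
likelihood ratio decays exponentially (`eventually_evidence_le_of_not_nested`). The required
behaviour of the noise holds with probability close to one by the inequalities of Markov and
Chebyshev, applied at each sample size separately, so the joint law of the samples is irrelevant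
(`exists_eventually_atypical_le`).
-/

namespace TypeIIML

/-! ### Gaussian and inverse gamma integrals -/

theorem lintegral_exp_neg_sq_mul {κ : Type*} [Fintype κ] {v : ℝ} (hv : 0 < v) :
    ∫⁻ x : κ → ℝ, ENNReal.ofReal (Real.exp (-(x ⬝ᵥ x) / (2 * v))) =
      ENNReal.ofReal (√((2 * Real.pi * v) ^ Fintype.card κ)) := by
  have h1 : ∀ x : κ → ℝ, Real.exp (-(x ⬝ᵥ x) / (2 * v)) =
      ∏ i, Real.exp (-(1 / (2 * v)) * x i ^ 2) := by
    intro x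
    rw [← Real.exp_sum]
    congr 1
    rw [← Finset.mul_sum, dotProduct]
    simp only [← sq]
    field_simp
  have hint : Integrable (fun x : ℝ => Real.exp (-(1 / (2 * v)) * x ^ 2)) :=
    integrable_exp_neg_mul_sq (by positivity)
  rw [← ofReal_integral_eq_lintegral_ofReal]
  · simp_rw [h1]
    rw [integral_fintype_prod_volume_eq_prod
      (f := fun _ (x : ℝ) => Real.exp (-(1 / (2 * v)) * x ^ 2))]
    simp only [integral_gaussian, Finset.prod_const, Finset.card_univ]
    rw [Real.sqrt_eq_rpow, Real.sqrt_eq_rpow, ← Real.rpow_natCast, ← Real.rpow_natCast,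
      ← Real.rpow_mul (by positivity), ← Real.rpow_mul (by positivity)]
    congr 2
    · field_simp
    · ring
  · simp_rw [h1]
    exact Integrable.fintype_prod (f := fun _ (x : ℝ) => Real.exp (-(1 / (2 * v)) * x ^ 2))
      (fun _ => hint)
  · exact Eventually.of_forall fun x => (Real.exp_pos _).le

open scoped MatrixOrder in
theorem exists_transpose_mul_self_eq {κ : Type*} [Fintype κ] [DecidableEq κ]
    {M : Matrix κ κ ℝ} (hM : M.PosDef) : ∃ B : Matrix κ κ ℝ, IsUnit B.det ∧ Bᵀ * B = M := by
  obtain ⟨B, hB⟩ := CStarAlgebra.nonneg_iff_eq_star_mul_self.mp hM.posSemidef.nonneg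
  rw [Matrix.star_eq_conjTranspose, Matrix.conjTranspose_eq_transpose_of_trivial] at hB
  refine ⟨B, ?_, hB.symm⟩
  have h := hM.det_pos
  rw [hB, Matrix.det_mul, Matrix.det_transpose] at h
  exact isUnit_iff_ne_zero.mpr (by rintro h0; simp [h0] at h)

/-- The unnormalised multivariate normal density with precision matrix `M / v` and mean `c`
has total mass `√((2πv)^k / det M)`. -/
theorem lintegral_exp_neg_quadForm {κ : Type*} [Fintype κ] [DecidableEq κ]
    {M : Matrix κ κ ℝ} (hM : M.PosDef) {v : ℝ} (hv : 0 < v) (c : κ → ℝ) :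
    ∫⁻ x : κ → ℝ, ENNReal.ofReal (Real.exp (-((x - c) ⬝ᵥ (M *ᵥ (x - c))) / (2 * v))) =
      ENNReal.ofReal (√((2 * Real.pi * v) ^ Fintype.card κ / M.det)) := by
  obtain ⟨B, hB, rfl⟩ := exists_transpose_mul_self_eq hM
  rw [lintegral_sub_right_eq_self
    (fun x => ENNReal.ofReal (Real.exp (-(x ⬝ᵥ ((Bᵀ * B) *ᵥ x)) / (2 * v)))) c]
  have h1 : ∀ x : κ → ℝ, x ⬝ᵥ ((Bᵀ * B) *ᵥ x) = (Matrix.toLin' B x) ⬝ᵥ (Matrix.toLin' B x) := by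
    intro x
    rw [Matrix.toLin'_apply, ← Matrix.mulVec_mulVec, Matrix.dotProduct_mulVec,
      Matrix.vecMul_transpose]
  have hmeas : Measurable (Matrix.toLin' B) :=
    (LinearMap.continuous_of_finiteDimensional _).measurable
  simp_rw [h1]
  rw [← lintegral_map (f := fun x : κ → ℝ => ENNReal.ofReal (Real.exp (-(x ⬝ᵥ x) / (2 * v))))
    (by unfold dotProduct; fun_prop) hmeas,
    Real.map_matrix_volume_pi_eq_smul_volume_pi hB.ne_zero, lintegral_smul_measure,
    lintegral_exp_neg_sq_mul hv, smul_eq_mul, ← ENNReal.ofReal_mul (abs_nonneg _),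
    Matrix.det_mul, Matrix.det_transpose, Real.sqrt_div (by positivity),
    Real.sqrt_mul_self_eq_abs, abs_inv]
  congr 1
  ring

/-- The inverse gamma integral; the substitution `v ↦ v⁻¹` turns it into Euler's integral. -/
theorem lintegral_rpow_mul_exp_neg_div {a s : ℝ} (ha : 0 < a) (hs : 0 < s) :
    ∫⁻ v in Set.Ioi (0 : ℝ), ENNReal.ofReal (v ^ (-a - 1) * Real.exp (-s / (2 * v))) =
      ENNReal.ofReal (2 ^ a * Real.Gamma a * s ^ (-a)) := by
  have hinv : Set.image (fun x : ℝ => x⁻¹) (Set.Ioi 0) = Set.Ioi 0 := by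
    ext x
    simp only [Set.mem_image, Set.mem_Ioi]
    exact ⟨fun ⟨y, hy, h⟩ => h ▸ inv_pos.mpr hy, fun h => ⟨x⁻¹, inv_pos.mpr h, inv_inv x⟩⟩
  rw [← hinv, lintegral_image_eq_lintegral_abs_deriv_mul (f' := fun x : ℝ => -(x ^ 2)⁻¹)
    measurableSet_Ioi (fun x hx => (hasDerivAt_inv (ne_of_gt hx)).hasDerivWithinAt)
    (fun x _ y _ h => inv_injective h)]
  have h2 : ∀ x ∈ Set.Ioi (0 : ℝ), ENNReal.ofReal |(-(x ^ 2)⁻¹)| *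
      ENNReal.ofReal (x⁻¹ ^ (-a - 1) * Real.exp (-s / (2 * x⁻¹))) =
      ENNReal.ofReal (x ^ (a - 1) * Real.exp (-(s / 2 * x))) := by
    intro x hx
    have hx' : (0 : ℝ) < x := hx
    rw [← ENNReal.ofReal_mul (abs_nonneg _), abs_neg, abs_of_pos (by positivity),
      Real.inv_rpow hx'.le, ← Real.rpow_neg hx'.le, ← mul_assoc, ← Real.rpow_natCast x 2,
      ← Real.rpow_neg hx'.le, ← Real.rpow_add hx']
    congr 3
    · push_cast; ring
    · field_simp
  rw [setLIntegral_congr_fun measurableSet_Ioi h2]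
  have hG := Real.integral_rpow_mul_exp_neg_mul_Ioi ha (half_pos hs)
  have hpos : 0 < (1 / (s / 2)) ^ a * Real.Gamma a :=
    mul_pos (by positivity) (Real.Gamma_pos_of_pos ha)
  rw [← ofReal_integral_eq_lintegral_ofReal, hG]
  · congr 1
    rw [Real.rpow_neg hs.le, one_div, Real.inv_rpow (by positivity), Real.div_rpow hs.le (by norm_num)]
    field_simp
  · by_contra h
    rw [integral_undef h] at hG
    exact hpos.ne hG
  · filter_upwards [ae_restrict_mem measurableSet_Ioi] with x hx
    have : (0 : ℝ) < x := hx
    positivity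

/-! ### The marginal likelihood in closed form -/

theorem posDef_transpose_eq {κ : Type*} [Fintype κ] {M : Matrix κ κ ℝ} (hM : M.PosDef) :
    Mᵀ = M := by
  rw [← Matrix.conjTranspose_eq_transpose_of_trivial, hM.isHermitian.eq]

theorem posDef_isUnit_det {κ : Type*} [Fintype κ] [DecidableEq κ] {M : Matrix κ κ ℝ}
    (hM : M.PosDef) : IsUnit M.det :=
  isUnit_iff_ne_zero.mpr hM.det_pos.ne'

theorem dotProduct_mulVec_comm_of_posDef {κ : Type*} [Fintype κ] {M : Matrix κ κ ℝ}
    (hM : M.PosDef) (x y : κ → ℝ) : x ⬝ᵥ (M *ᵥ y) = y ⬝ᵥ (M *ᵥ x) := by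
  rw [Matrix.dotProduct_mulVec, dotProduct_comm, ← Matrix.mulVec_transpose,
    posDef_transpose_eq hM]

theorem quadForm_sub_inv_mulVec {κ : Type*} [Fintype κ] [DecidableEq κ] {M : Matrix κ κ ℝ}
    (hM : M.PosDef) (w x : κ → ℝ) :
    (x - M⁻¹ *ᵥ w) ⬝ᵥ (M *ᵥ (x - M⁻¹ *ᵥ w)) =
      x ⬝ᵥ (M *ᵥ x) - 2 * (w ⬝ᵥ x) + w ⬝ᵥ (M⁻¹ *ᵥ w) := by
  have h1 : M *ᵥ (M⁻¹ *ᵥ w) = w := by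
    rw [Matrix.mulVec_mulVec, Matrix.mul_nonsing_inv _ (posDef_isUnit_det hM), Matrix.one_mulVec]
  rw [Matrix.mulVec_sub, h1, sub_dotProduct, dotProduct_sub, dotProduct_sub,
    dotProduct_mulVec_comm_of_posDef hM (M⁻¹ *ᵥ w) x, h1, dotProduct_comm x w,
    dotProduct_comm (M⁻¹ *ᵥ w) w]
  ring

/-- The minimum over `β₀` and `β` of the penalised sum of squares
`|y - X₀ β₀ - X β|² + βᵀ W⁻¹ β`, when `X₀ᵀ X = 0` and the matrices inverted here are positive
definite; see `penalized_sq_eq`. -/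
noncomputable def penalizedRSS {n p₀ : ℕ} {κ : Type*} [Fintype κ] [DecidableEq κ]
    (X₀ : Matrix (Fin n) (Fin p₀) ℝ) (X : Matrix (Fin n) κ ℝ) (W : Matrix κ κ ℝ)
    (y : Fin n → ℝ) : ℝ :=
  y ⬝ᵥ y - (X₀ᵀ *ᵥ y) ⬝ᵥ ((X₀ᵀ * X₀)⁻¹ *ᵥ (X₀ᵀ *ᵥ y)) -
    (Xᵀ *ᵥ y) ⬝ᵥ ((Xᵀ * X + W⁻¹)⁻¹ *ᵥ (Xᵀ *ᵥ y))

/-- Completing the square in `β₀` and `β`; there is no cross term because `X₀ᵀ X = 0`. -/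
theorem penalized_sq_eq {n p₀ : ℕ} {κ : Type*} [Fintype κ] [DecidableEq κ]
    {X₀ : Matrix (Fin n) (Fin p₀) ℝ} {X : Matrix (Fin n) κ ℝ} {W : Matrix κ κ ℝ}
    (h₀ : (X₀ᵀ * X₀).PosDef) (horth : X₀ᵀ * X = 0) (hM : (Xᵀ * X + W⁻¹).PosDef)
    (y : Fin n → ℝ) (a : Fin p₀ → ℝ) (b : κ → ℝ) :
    (y - (X₀ *ᵥ a + X *ᵥ b)) ⬝ᵥ (y - (X₀ *ᵥ a + X *ᵥ b)) + b ⬝ᵥ (W⁻¹ *ᵥ b) =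
      penalizedRSS X₀ X W y +
      (a - (X₀ᵀ * X₀)⁻¹ *ᵥ (X₀ᵀ *ᵥ y)) ⬝ᵥ
        ((X₀ᵀ * X₀) *ᵥ (a - (X₀ᵀ * X₀)⁻¹ *ᵥ (X₀ᵀ *ᵥ y))) +
      (b - (Xᵀ * X + W⁻¹)⁻¹ *ᵥ (Xᵀ *ᵥ y)) ⬝ᵥ
        ((Xᵀ * X + W⁻¹) *ᵥ (b - (Xᵀ * X + W⁻¹)⁻¹ *ᵥ (Xᵀ *ᵥ y))) := by
  rw [quadForm_sub_inv_mulVec h₀, quadForm_sub_inv_mulVec hM, penalizedRSS, Matrix.add_mulVec]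
  have e1 : (X₀ *ᵥ a) ⬝ᵥ (X *ᵥ b) = 0 := by
    rw [Matrix.dotProduct_mulVec, ← Matrix.mulVec_transpose, Matrix.mulVec_mulVec]
    have : Xᵀ * X₀ = 0 := by rw [← Matrix.transpose_transpose (Xᵀ * X₀)]; simp [horth]
    simp [this]
  have e2 : y ⬝ᵥ (X₀ *ᵥ a) = (X₀ᵀ *ᵥ y) ⬝ᵥ a := by
    rw [Matrix.dotProduct_mulVec, Matrix.mulVec_transpose]
  have e3 : y ⬝ᵥ (X *ᵥ b) = (Xᵀ *ᵥ y) ⬝ᵥ b := by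
    rw [Matrix.dotProduct_mulVec, Matrix.mulVec_transpose]
  have e4 : a ⬝ᵥ ((X₀ᵀ * X₀) *ᵥ a) = (X₀ *ᵥ a) ⬝ᵥ (X₀ *ᵥ a) := by
    rw [← Matrix.mulVec_mulVec, Matrix.dotProduct_mulVec, Matrix.vecMul_transpose]
  have e5 : b ⬝ᵥ ((Xᵀ * X) *ᵥ b) = (X *ᵥ b) ⬝ᵥ (X *ᵥ b) := by
    rw [← Matrix.mulVec_mulVec, Matrix.dotProduct_mulVec, Matrix.vecMul_transpose]
  simp only [sub_dotProduct, dotProduct_sub, add_dotProduct, dotProduct_add]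
  rw [e4, e5, ← e2, ← e3, dotProduct_comm (X₀ *ᵥ a) y, dotProduct_comm (X *ᵥ b) y,
    dotProduct_comm (X *ᵥ b) (X₀ *ᵥ a), e1]
  ring

/-- The factor of the marginal likelihood that depends neither on `W` nor on the model. -/
noncomputable def evidenceConst {n p₀ : ℕ} (X₀ : Matrix (Fin n) (Fin p₀) ℝ) : ℝ :=
  (√((2 * Real.pi) ^ n))⁻¹ * √((2 * Real.pi) ^ p₀ / (X₀ᵀ * X₀).det) *
    (2 ^ (((n : ℝ) - p₀) / 2) * Real.Gamma (((n : ℝ) - p₀) / 2))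

theorem evidenceConst_pos {n p₀ : ℕ} {X₀ : Matrix (Fin n) (Fin p₀) ℝ}
    (h₀ : (X₀ᵀ * X₀).PosDef) (hn : p₀ < n) : 0 < evidenceConst X₀ := by
  have h1 : (0 : ℝ) < ((n : ℝ) - p₀) / 2 := by
    have : (p₀ : ℝ) < n := by exact_mod_cast hn
    linarith
  have := Real.Gamma_pos_of_pos h1
  have := h₀.det_pos
  unfold evidenceConst
  positivity

theorem normalDensity_smul {ι : Type*} [Fintype ι] [DecidableEq ι] (y m : ι → ℝ)
    {S : Matrix ι ι ℝ} (hS : S.PosDef) {v : ℝ} (hv : 0 < v) :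
    normalDensity y m (v • S) =
      (√((2 * Real.pi * v) ^ Fintype.card ι))⁻¹ * (√S.det)⁻¹ *
        Real.exp (-((y - m) ⬝ᵥ (S⁻¹ *ᵥ (y - m))) / (2 * v)) := by
  have hinv : (v • S)⁻¹ = v⁻¹ • S⁻¹ := by
    apply Matrix.inv_eq_right_inv
    rw [Matrix.smul_mul, Matrix.mul_smul, smul_smul, mul_inv_cancel₀ hv.ne', one_smul,
      Matrix.mul_nonsing_inv _ (posDef_isUnit_det hS)]
  rw [normalDensity, hinv, Matrix.det_smul, ← mul_assoc, ← mul_pow, Real.sqrt_mul (by positivity),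
    mul_inv, Matrix.smul_mulVec, dotProduct_smul, smul_eq_mul]
  congr 2
  field_simp

/-- Tonelli's theorem for an integrand that factorizes once the innermost variable is fixed. -/
theorem lintegral_lintegral_lintegral_mul_mul {α β γ : Type*} [MeasurableSpace α]
    [MeasurableSpace β] [MeasurableSpace γ] {μ : Measure α} {ν : Measure β} {ρ : Measure γ}
    [SFinite μ] [SFinite ν] [SFinite ρ] {f : γ → ℝ≥0∞} {g : α → γ → ℝ≥0∞} {h : β → γ → ℝ≥0∞}
    (hf : Measurable f) (hg : Measurable fun q : α × γ => g q.1 q.2)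
    (hh : Measurable fun q : β × γ => h q.1 q.2) :
    ∫⁻ a, ∫⁻ b, ∫⁻ c, f c * g a c * h b c ∂ρ ∂ν ∂μ =
      ∫⁻ c, f c * (∫⁻ a, g a c ∂μ) * (∫⁻ b, h b c ∂ν) ∂ρ := by
  have hH : Measurable fun c => ∫⁻ b, h b c ∂ν := hh.lintegral_prod_left'
  have h₁ : ∀ a, ∫⁻ b, ∫⁻ c, f c * g a c * h b c ∂ρ ∂ν =
      ∫⁻ c, f c * g a c * (∫⁻ b, h b c ∂ν) ∂ρ := by
    intro a
    have hga : Measurable (fun c => g a c) := hg.comp measurable_prodMk_left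
    rw [lintegral_lintegral_swap (((hf.mul hga).comp measurable_snd).mul hh).aemeasurable]
    exact lintegral_congr fun c => lintegral_const_mul _ (hh.comp measurable_prodMk_right)
  simp_rw [h₁]
  rw [lintegral_lintegral_swap
    (((hf.comp measurable_snd).mul hg).mul (hH.comp measurable_snd)).aemeasurable]
  refine lintegral_congr fun c => ?_
  have hgc : Measurable (fun a => g a c) := hg.comp measurable_prodMk_right
  rw [lintegral_mul_const _ (hgc.const_mul _), lintegral_const_mul _ hgc]

/-- Integrating out `β₀`, `β` and `σ²`: completing the square turns the integral into two
Gaussian integrals and one inverse gamma integral. -/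
theorem marginalLikelihood_eq {n p₀ : ℕ} {κ : Type*} [Fintype κ] [DecidableEq κ]
    {X₀ : Matrix (Fin n) (Fin p₀) ℝ} {X : Matrix (Fin n) κ ℝ} {W : Matrix κ κ ℝ}
    (h₀ : (X₀ᵀ * X₀).PosDef) (horth : X₀ᵀ * X = 0) (hW : W.PosDef) (hn : p₀ < n)
    {y : Fin n → ℝ} (hS : 0 < penalizedRSS X₀ X W y) :
    marginalLikelihood X₀ X W y = ENNReal.ofReal (evidenceConst X₀ *
      (√(W.det * (Xᵀ * X + W⁻¹).det))⁻¹ *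
        penalizedRSS X₀ X W y ^ (-(((n : ℝ) - p₀) / 2))) := by
  have hM : (Xᵀ * X + W⁻¹).PosDef := by
    refine Matrix.PosDef.posSemidef_add ?_ hW.inv
    simpa using Matrix.posSemidef_conjTranspose_mul_self X
  set S := penalizedRSS X₀ X W y with hSdef
  set M := Xᵀ * X + W⁻¹ with hMdef
  set c₀ := (X₀ᵀ * X₀)⁻¹ *ᵥ (X₀ᵀ *ᵥ y) with hc₀
  set c := M⁻¹ *ᵥ (Xᵀ *ᵥ y) with hc
  set k := Fintype.card κ with hk
  let F (v : ℝ) : ℝ≥0∞ := ENNReal.ofReal ((√((2 * Real.pi * v) ^ n))⁻¹ *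
    ((√((2 * Real.pi * v) ^ k))⁻¹ * (√W.det)⁻¹) * (1 / v) * Real.exp (-S / (2 * v)))
  let F₀ (a : Fin p₀ → ℝ) (v : ℝ) : ℝ≥0∞ :=
    ENNReal.ofReal (Real.exp (-((a - c₀) ⬝ᵥ ((X₀ᵀ * X₀) *ᵥ (a - c₀))) / (2 * v)))
  let F₁ (b : κ → ℝ) (v : ℝ) : ℝ≥0∞ :=
    ENNReal.ofReal (Real.exp (-((b - c) ⬝ᵥ (M *ᵥ (b - c))) / (2 * v)))
  have hFm : Measurable F := by fun_prop
  have hF₀m : Measurable (fun q : (Fin p₀ → ℝ) × ℝ => F₀ q.1 q.2) := by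
    refine ENNReal.measurable_ofReal.comp (Real.measurable_exp.comp (Measurable.div ?_ ?_))
    · exact Continuous.measurable (by fun_prop)
    · fun_prop
  have hF₁m : Measurable (fun q : (κ → ℝ) × ℝ => F₁ q.1 q.2) := by
    refine ENNReal.measurable_ofReal.comp (Real.measurable_exp.comp (Measurable.div ?_ ?_))
    · exact Continuous.measurable (by fun_prop)
    · fun_prop
  -- For `v > 0` the integrand splits into a factor for `β₀`, one for `β` and one for `v` alone.
  have hfac : ∀ (a : Fin p₀ → ℝ) (b : κ → ℝ), ∀ v ∈ Set.Ioi (0 : ℝ),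
      ENNReal.ofReal (normalDensity y (X₀ *ᵥ a + X *ᵥ b) (v • (1 : Matrix (Fin n) (Fin n) ℝ)) *
        normalDensity b 0 (v • W) * (1 / v)) = F v * F₀ a v * F₁ b v := by
    intro a b v hv
    have hv' : (0 : ℝ) < v := hv
    rw [normalDensity_smul _ _ Matrix.PosDef.one hv', normalDensity_smul _ _ hW hv',
      ← ENNReal.ofReal_mul (by positivity), ← ENNReal.ofReal_mul (by positivity)]
    congr 1
    have hexp : Real.exp (-S / (2 * v)) *
        Real.exp (-((a - c₀) ⬝ᵥ ((X₀ᵀ * X₀) *ᵥ (a - c₀))) / (2 * v)) *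
        Real.exp (-((b - c) ⬝ᵥ (M *ᵥ (b - c))) / (2 * v)) =
        Real.exp (-((y - (X₀ *ᵥ a + X *ᵥ b)) ⬝ᵥ (y - (X₀ *ᵥ a + X *ᵥ b))) / (2 * v)) *
        Real.exp (-(b ⬝ᵥ (W⁻¹ *ᵥ b)) / (2 * v)) := by
      rw [← Real.exp_add, ← Real.exp_add, ← Real.exp_add]
      congr 1
      have := penalized_sq_eq h₀ horth hM y a b
      rw [← hSdef] at this
      rw [← add_div, ← add_div, ← add_div]
      congr 1
      linarith
    rw [inv_one, Matrix.one_mulVec, Matrix.det_one, Real.sqrt_one, inv_one, mul_one, sub_zero,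
      Fintype.card_fin]
    linear_combination -((√((2 * Real.pi * v) ^ n))⁻¹ *
      ((√((2 * Real.pi * v) ^ k))⁻¹ * (√W.det)⁻¹) * (1 / v)) * hexp
  have hν : 0 < ((n : ℝ) - p₀) / 2 := by
    have : (p₀ : ℝ) < n := by exact_mod_cast hn
    linarith
  unfold marginalLikelihood
  simp_rw [fun a b => setLIntegral_congr_fun (μ := volume) measurableSet_Ioi (hfac a b)]
  rw [lintegral_lintegral_lintegral_mul_mul hFm hF₀m hF₁m]
  have hfinal : ∀ v ∈ Set.Ioi (0 : ℝ), F v * (∫⁻ a, F₀ a v) * (∫⁻ b, F₁ b v) =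
      ENNReal.ofReal ((√((2 * Real.pi) ^ n))⁻¹ * √((2 * Real.pi) ^ p₀ / (X₀ᵀ * X₀).det) *
        (√(W.det * M.det))⁻¹) *
      ENNReal.ofReal (v ^ (-(((n : ℝ) - p₀) / 2) - 1) * Real.exp (-S / (2 * v))) := by
    intro v hv
    have hv' : (0 : ℝ) < v := hv
    have hd0 := h₀.det_pos
    have hdW := hW.det_pos
    have hdM := hM.det_pos
    have hsq : ∀ m : ℕ, √(v ^ m) = v ^ ((m : ℝ) / 2) := fun m => by
      rw [Real.sqrt_eq_rpow, ← Real.rpow_natCast, ← Real.rpow_mul hv'.le]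
      congr 1; ring
    rw [lintegral_exp_neg_quadForm h₀ hv', lintegral_exp_neg_quadForm hM hv', Fintype.card_fin, ← hk,
      ← ENNReal.ofReal_mul (by positivity), ← ENNReal.ofReal_mul (by positivity),
      ← ENNReal.ofReal_mul (by positivity)]
    congr 1
    -- The powers of `v`: `-n/2 - k/2` from the densities, `-1` from the prior, `p₀/2 + k/2` from
    -- the two Gaussian integrals.
    have hvpow : v ^ (-(((n : ℝ) - p₀) / 2) - 1) = (√(v ^ n))⁻¹ * √(v ^ p₀) * (1 / v) := by
      rw [hsq, hsq, ← Real.rpow_neg hv'.le, ← Real.rpow_add hv', one_div, ← Real.rpow_neg_one v,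
        ← Real.rpow_add hv']
      congr 1; ring
    rw [hvpow, mul_pow _ v n, mul_pow _ v p₀, Real.sqrt_mul (by positivity) (v ^ n),
      mul_div_right_comm, Real.sqrt_mul (by positivity) (v ^ p₀),
      Real.sqrt_div (by positivity) M.det, Real.sqrt_mul hdW.le]
    have h1 : √((2 * Real.pi * v) ^ k) ≠ 0 := by positivity
    field_simp
  rw [setLIntegral_congr_fun measurableSet_Ioi hfinal, lintegral_const_mul _ (by fun_prop),
    lintegral_rpow_mul_exp_neg_div hν hS, ← ENNReal.ofReal_mul (by positivity)]
  congr 1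
  rw [evidenceConst]
  ring

/-! ### Whitened coordinates and existence of the maximizer -/

/-- The squared length of the projection of `y` onto the columns of `X`. -/
noncomputable def fitSq {n : ℕ} {κ : Type*} [Fintype κ] [DecidableEq κ]
    (X : Matrix (Fin n) κ ℝ) (y : Fin n → ℝ) : ℝ :=
  (Xᵀ *ᵥ y) ⬝ᵥ ((Xᵀ * X)⁻¹ *ᵥ (Xᵀ *ᵥ y))

/-- The residual sum of squares of the least squares fit of `y` by the columns of `X₀` and `X`,
when `X₀ᵀ X = 0`. -/
noncomputable def rss {n p₀ : ℕ} {κ : Type*} [Fintype κ] [DecidableEq κ]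
    (X₀ : Matrix (Fin n) (Fin p₀) ℝ) (X : Matrix (Fin n) κ ℝ) (y : Fin n → ℝ) : ℝ :=
  y ⬝ᵥ y - fitSq X₀ y - fitSq X y

/-- The marginal likelihood, up to the common constant, as a function of the prior covariance
matrix `A` in coordinates in which the design is orthonormal. Here `T` is the residual sum of
squares, `u` the vector of regression coefficients and `a` half the degrees of freedom. -/
noncomputable def whitenedEvidence {κ : Type*} [Fintype κ] [DecidableEq κ] (T a : ℝ) (u : κ → ℝ)
    (A : Matrix κ κ ℝ) : ℝ :=
  (√(1 + A).det)⁻¹ * (T + u ⬝ᵥ ((1 + A)⁻¹ *ᵥ u)) ^ (-a)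

section Whitening

variable {n p₀ : ℕ} {κ : Type*} [Fintype κ] [DecidableEq κ]

/-- Coordinates `β = C θ` in which the Gram matrix `G` becomes the identity. A prior covariance
matrix `A` of `θ` corresponds to the prior covariance matrix `C A Cᵀ` of `β`. -/
theorem exists_whitening {G : Matrix κ κ ℝ} (hG : G.PosDef) :
    ∃ C : Matrix κ κ ℝ, IsUnit C.det ∧ Cᵀ * G * C = 1 := by
  obtain ⟨B, hB, rfl⟩ := exists_transpose_mul_self_eq hG
  refine ⟨B⁻¹, Matrix.isUnit_nonsing_inv_det B hB, ?_⟩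
  rw [Matrix.mul_assoc, Matrix.mul_assoc, Matrix.mul_nonsing_inv _ hB, Matrix.mul_one,
    ← Matrix.transpose_mul, Matrix.mul_nonsing_inv _ hB, Matrix.transpose_one]

variable {G C A : Matrix κ κ ℝ}

theorem whitening_gram_eq (hC : IsUnit C.det) (hCG : Cᵀ * G * C = 1) : G = (C⁻¹)ᵀ * C⁻¹ := by
  have hCt : IsUnit Cᵀ.det := by rwa [Matrix.det_transpose]
  rw [Matrix.transpose_nonsing_inv]
  calc G = (Cᵀ⁻¹ * Cᵀ) * G * (C * C⁻¹) := by
        rw [Matrix.mul_nonsing_inv _ hC, Matrix.nonsing_inv_mul _ hCt, Matrix.one_mul,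
          Matrix.mul_one]
    _ = Cᵀ⁻¹ * (Cᵀ * G * C) * C⁻¹ := by simp only [Matrix.mul_assoc]
    _ = Cᵀ⁻¹ * C⁻¹ := by rw [hCG, Matrix.mul_one]

theorem whitening_gram_inv (hC : IsUnit C.det) (hCG : Cᵀ * G * C = 1) : G⁻¹ = C * Cᵀ := by
  rw [whitening_gram_eq hC hCG, Matrix.mul_inv_rev, ← Matrix.transpose_nonsing_inv,
    Matrix.nonsing_inv_nonsing_inv _ hC]

theorem whitening_add_inv_eq (hC : IsUnit C.det) (hCG : Cᵀ * G * C = 1) :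
    G + (C * A * Cᵀ)⁻¹ = (C⁻¹)ᵀ * (1 + A⁻¹) * C⁻¹ := by
  rw [Matrix.mul_inv_rev, Matrix.mul_inv_rev, ← Matrix.transpose_nonsing_inv, Matrix.mul_add,
    Matrix.add_mul, Matrix.mul_one, ← whitening_gram_eq hC hCG, Matrix.mul_assoc]

theorem isUnit_det_one_add (hA : A.PosDef) : IsUnit (1 + A).det :=
  posDef_isUnit_det (Matrix.PosDef.one.add hA)

theorem whitening_add_inv_inv (hC : IsUnit C.det) (hCG : Cᵀ * G * C = 1) (hA : A.PosDef) :
    (G + (C * A * Cᵀ)⁻¹)⁻¹ = C * Cᵀ - C * (1 + A)⁻¹ * Cᵀ := by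
  have h1 : (1 + A⁻¹)⁻¹ = 1 - (1 + A)⁻¹ := by
    apply Matrix.inv_eq_right_inv
    have hu := isUnit_det_one_add hA
    have e1 : (1 : Matrix κ κ ℝ) - (1 + A)⁻¹ = A * (1 + A)⁻¹ := by
      nth_rewrite 1 [← Matrix.mul_nonsing_inv _ hu]
      rw [Matrix.add_mul, Matrix.one_mul, add_sub_cancel_left]
    rw [e1, ← Matrix.mul_assoc, Matrix.add_mul, Matrix.one_mul,
      Matrix.nonsing_inv_mul _ (posDef_isUnit_det hA), add_comm A 1, Matrix.mul_nonsing_inv _ hu]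
  rw [whitening_add_inv_eq hC hCG, Matrix.mul_inv_rev, Matrix.mul_inv_rev, h1,
    ← Matrix.transpose_nonsing_inv, Matrix.nonsing_inv_nonsing_inv _ hC, ← Matrix.mul_assoc,
    Matrix.mul_sub, Matrix.sub_mul, Matrix.mul_one]

theorem whitening_det_mul_det (hC : IsUnit C.det) (hCG : Cᵀ * G * C = 1) (hA : A.PosDef) :
    (C * A * Cᵀ).det * (G + (C * A * Cᵀ)⁻¹).det = (1 + A).det := by
  have e : A.det * (1 + A⁻¹).det = (1 + A).det := by
    rw [← Matrix.det_mul, Matrix.mul_add, Matrix.mul_one,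
      Matrix.mul_nonsing_inv _ (posDef_isUnit_det hA), add_comm]
  rw [whitening_add_inv_eq hC hCG, ← e]
  simp only [Matrix.det_mul, Matrix.det_transpose]
  have : C.det * (C⁻¹).det = 1 := by
    rw [← Matrix.det_mul, Matrix.mul_nonsing_inv _ hC, Matrix.det_one]
  linear_combination (A.det * (1 + A⁻¹).det * (1 + C.det * (C⁻¹).det)) * this

theorem dotProduct_conj_mulVec {ι : Type*} [Fintype ι] (C D : Matrix ι ι ℝ) (w : ι → ℝ) :
    w ⬝ᵥ ((C * D * Cᵀ) *ᵥ w) = (Cᵀ *ᵥ w) ⬝ᵥ (D *ᵥ (Cᵀ *ᵥ w)) := by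
  rw [← Matrix.mulVec_mulVec, ← Matrix.mulVec_mulVec, Matrix.dotProduct_mulVec,
    ← Matrix.mulVec_transpose]

variable {X₀ : Matrix (Fin n) (Fin p₀) ℝ} {X : Matrix (Fin n) κ ℝ}

theorem fitSq_eq_whitened (hC : IsUnit C.det) (hCG : Cᵀ * (Xᵀ * X) * C = 1) (y : Fin n → ℝ) :
    fitSq X y = (Cᵀ *ᵥ (Xᵀ *ᵥ y)) ⬝ᵥ (Cᵀ *ᵥ (Xᵀ *ᵥ y)) := by
  have := dotProduct_conj_mulVec C 1 (Xᵀ *ᵥ y)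
  rw [Matrix.mul_one, Matrix.one_mulVec] at this
  rw [fitSq, whitening_gram_inv hC hCG, this]

theorem penalizedRSS_eq_whitened (hC : IsUnit C.det) (hCG : Cᵀ * (Xᵀ * X) * C = 1)
    (hA : A.PosDef) (y : Fin n → ℝ) :
    penalizedRSS X₀ X (C * A * Cᵀ) y = rss X₀ X y +
      (Cᵀ *ᵥ (Xᵀ *ᵥ y)) ⬝ᵥ ((1 + A)⁻¹ *ᵥ (Cᵀ *ᵥ (Xᵀ *ᵥ y))) := by
  rw [penalizedRSS, rss, fitSq, fitSq, whitening_add_inv_inv hC hCG hA, whitening_gram_inv hC hCG,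
    Matrix.sub_mulVec, dotProduct_sub, ← dotProduct_conj_mulVec]
  ring

theorem posDef_of_sub_smul_one {ι : Type*} [DecidableEq ι] {A : Matrix ι ι ℝ} {c : ℝ}
    (hc : 0 < c) (hA : (A - c • 1).PosSemidef) :
    A.PosDef := by
  have := Matrix.PosDef.posSemidef_add hA (Matrix.PosDef.one.smul hc)
  simpa using this

/-- The determinant factor and the penalised sum of squares of `marginalLikelihood_eq`, expressed
through the whitened prior covariance matrix `A`. -/
theorem marginalLikelihood_whitened (h₀ : (X₀ᵀ * X₀).PosDef) (horth : X₀ᵀ * X = 0)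
    (hC : IsUnit C.det) (hCG : Cᵀ * (Xᵀ * X) * C = 1) (hA : A.PosDef) (hn : p₀ < n)
    {y : Fin n → ℝ} (hT : 0 < rss X₀ X y) :
    marginalLikelihood X₀ X (C * A * Cᵀ) y = ENNReal.ofReal (evidenceConst X₀ *
      whitenedEvidence (rss X₀ X y) (((n : ℝ) - p₀) / 2) (Cᵀ *ᵥ (Xᵀ *ᵥ y)) A) := by
  have hW : (C * A * Cᵀ).PosDef := by
    have := (Matrix.IsUnit.posDef_star_right_conjugate_iff (x := A)
      ((Matrix.isUnit_iff_isUnit_det C).mpr hC)).mpr hA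
    simpa [Matrix.star_eq_conjTranspose] using this
  have hS := penalizedRSS_eq_whitened (X₀ := X₀) hC hCG hA y
  have hpos : 0 < penalizedRSS X₀ X (C * A * Cᵀ) y := by
    rw [hS]
    have := (Matrix.PosDef.one.add hA).inv.posSemidef.dotProduct_mulVec_nonneg
      (Cᵀ *ᵥ (Xᵀ *ᵥ y))
    simp only [star_trivial] at this
    linarith
  rw [marginalLikelihood_eq h₀ horth hW hn hpos, whitening_det_mul_det hC hCG hA, hS,
    whitenedEvidence, mul_assoc]

theorem posSemidef_sub_lowerBound_iff (hC : IsUnit C.det) (hCG : Cᵀ * (Xᵀ * X) * C = 1) :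
    (C * A * Cᵀ - lowerBound X).PosSemidef ↔ (A - (n : ℝ) • 1).PosSemidef := by
  have e : C * A * Cᵀ - lowerBound X = C * (A - (n : ℝ) • 1) * star C := by
    rw [lowerBound, whitening_gram_inv hC hCG, Matrix.star_eq_conjTranspose,
      Matrix.conjTranspose_eq_transpose_of_trivial, Matrix.mul_sub, Matrix.sub_mul]
    simp
  rw [e, Matrix.IsUnit.posSemidef_star_right_conjugate_iff
      ((Matrix.isUnit_iff_isUnit_det C).mpr hC)]

theorem exists_eq_conj (hC : IsUnit C.det) (W : Matrix κ κ ℝ) : ∃ A, W = C * A * Cᵀ := by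
  have hCt : IsUnit Cᵀ.det := by rwa [Matrix.det_transpose]
  refine ⟨C⁻¹ * W * Cᵀ⁻¹, ?_⟩
  rw [Matrix.mul_assoc C⁻¹ W, ← Matrix.mul_assoc C, Matrix.mul_nonsing_inv _ hC, Matrix.one_mul,
    Matrix.mul_assoc W, Matrix.nonsing_inv_mul _ hCt, Matrix.mul_one]

theorem eigenvalues_one_add_ge {c : ℝ} (hA : (A - c • 1).PosSemidef)
    (hH : (1 + A).IsHermitian) (i : κ) : 1 + c ≤ hH.eigenvalues i := by
  have h := hA.dotProduct_mulVec_nonneg (hH.eigenvectorBasis i).ofLp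
  have e : A - c • 1 = (1 + A) - (1 + c) • 1 := by rw [add_smul, one_smul]; abel
  have hnorm : (hH.eigenvectorBasis i).ofLp ⬝ᵥ (hH.eigenvectorBasis i).ofLp = 1 := by
    have := hH.eigenvectorBasis.orthonormal.1 i
    have h2 := EuclideanSpace.real_norm_sq_eq (hH.eigenvectorBasis i)
    rw [this] at h2
    simp only [dotProduct, ← sq]
    linarith
  rw [e, Matrix.sub_mulVec, hH.mulVec_eigenvectorBasis, Matrix.smul_mulVec, Matrix.one_mulVec,
    star_trivial, dotProduct_sub, dotProduct_smul, dotProduct_smul, hnorm] at h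
  simp at h
  linarith

theorem isHermitian_one_add {ι : Type*} [DecidableEq ι] {A : Matrix ι ι ℝ} {c : ℝ}
    (hA : (A - c • 1).PosSemidef) : (1 + A).IsHermitian := by
  have h1 : A = (A - c • 1) + c • 1 := by simp
  rw [h1]
  exact Matrix.isHermitian_one.add
    (hA.isHermitian.add (Matrix.isHermitian_one.smul (IsSelfAdjoint.all c)))

theorem pow_le_det_one_add {c : ℝ} (hc : 0 ≤ c) (hA : (A - c • 1).PosSemidef) :
    (1 + c) ^ Fintype.card κ ≤ (1 + A).det := by
  have hH := isHermitian_one_add hA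
  rw [hH.det_eq_prod_eigenvalues, ← Finset.card_univ, ← Finset.prod_const]
  exact Finset.prod_le_prod (fun _ _ => by positivity) fun i _ => eigenvalues_one_add_ge hA hH i

/-- All eigenvalues of `1 + A` are at least one, so each of them is at most the determinant. -/
theorem abs_apply_le_of_det_le {c R : ℝ} (hc : 0 ≤ c) (hA : (A - c • 1).PosSemidef)
    (hR : (1 + A).det ≤ R) (i j : κ) : |A i j| ≤ Fintype.card κ * R := by
  have hH := isHermitian_one_add hA
  have h1 : ∀ i, 1 ≤ hH.eigenvalues i := fun i =>
    le_trans (by linarith) (eigenvalues_one_add_ge hA hH i)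
  have hle : ∀ i, hH.eigenvalues i ≤ R := by
    intro i
    refine le_trans ?_ hR
    rw [hH.det_eq_prod_eigenvalues]
    -- every factor of the determinant other than the `i`-th one is bounded below by one
    calc hH.eigenvalues i = ∏ j, if j = i then hH.eigenvalues j else 1 := by simp
      _ ≤ ∏ j, hH.eigenvalues j := by
        refine Finset.prod_le_prod (fun j _ => ?_) fun j _ => ?_
        · split_ifs <;> linarith [h1 j]
        · split_ifs <;> linarith [h1 j]
  have hAp : A.PosSemidef := by
    have := hA.add (Matrix.PosSemidef.one.smul hc)
    simpa using this
  have htr : (1 + A).trace ≤ Fintype.card κ * R := by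
    rw [hH.trace_eq_sum_eigenvalues]
    calc _ ≤ ∑ _i : κ, R := Finset.sum_le_sum fun i _ => hle i
      _ = _ := by simp
  have hdiag : ∀ i, A i i ≤ Fintype.card κ * R := by
    intro i
    refine le_trans ?_ htr
    have h2 : A i i ≤ A.trace := by
      rw [Matrix.trace]
      exact Finset.single_le_sum (f := A.diag) (fun i _ => hAp.diag_nonneg) (Finset.mem_univ i)
    rw [Matrix.trace_add, Matrix.trace_one]
    have : (0 : ℝ) ≤ Fintype.card κ := by positivity
    linarith
  have hsymm : A j i = A i j := by simpa using hAp.isHermitian.apply i j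
  have hq : ∀ t : ℝ, 0 ≤ A i i + 2 * t * A i j + t ^ 2 * A j j := by
    intro t
    have := hAp.dotProduct_mulVec_nonneg (Pi.single i 1 + t • Pi.single j 1)
    simp [Matrix.mulVec_add, Matrix.mulVec_smul, hsymm] at this
    linarith
  -- the test vectors `e i ± e j` bound `|A i j|` by the mean of two diagonal entries
  have h2 := hq 1
  have h3 := hq (-1)
  have h4 := hdiag i
  have h5 := hdiag j
  rw [abs_le]
  constructor <;> linarith

theorem whitenedEvidence_le {T a c : ℝ} (hT : 0 < T) (ha : 0 ≤ a) (hc : 0 ≤ c) (u : κ → ℝ)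
    (hA : (A - c • 1).PosSemidef) :
    whitenedEvidence T a u A ≤ (√(1 + A).det)⁻¹ * T ^ (-a) := by
  have hAp : A.PosSemidef := by
    have := hA.add (Matrix.PosSemidef.one.smul hc)
    simpa using this
  have hu := (Matrix.PosDef.one.add_posSemidef hAp).inv.posSemidef.dotProduct_mulVec_nonneg u
  simp only [star_trivial] at hu
  refine mul_le_mul_of_nonneg_left ?_ (by positivity)
  exact Real.rpow_le_rpow_of_nonpos hT (by linarith) (by linarith)

theorem whitenedEvidence_smul_one {T a c : ℝ} (hc : 0 ≤ c) (u : κ → ℝ) :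
    whitenedEvidence T a u (c • 1) =
      (√((1 + c) ^ Fintype.card κ))⁻¹ * (T + u ⬝ᵥ u / (1 + c)) ^ (-a) := by
  have e : (1 : Matrix κ κ ℝ) + c • 1 = (1 + c) • 1 := by rw [add_smul, one_smul]
  have hinv : ((1 + c) • (1 : Matrix κ κ ℝ))⁻¹ = (1 + c)⁻¹ • 1 := by
    apply Matrix.inv_eq_right_inv
    rw [Matrix.smul_mul, Matrix.mul_smul, smul_smul, mul_inv_cancel₀ (by positivity), one_smul,
      Matrix.one_mul]
  rw [whitenedEvidence, e, hinv, Matrix.det_smul, Matrix.det_one, mul_one, Matrix.smul_mulVec,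
    Matrix.one_mulVec, dotProduct_smul, smul_eq_mul]
  congr 3
  ring

theorem isClosed_setOf_posSemidef_sub {ι : Type*} [Fintype ι] (B : Matrix ι ι ℝ) :
    IsClosed {A : Matrix ι ι ℝ | (A - B).PosSemidef} := by
  have : {A : Matrix ι ι ℝ | (A - B).PosSemidef} =
      {A | (A - B)ᴴ = A - B} ∩ ⋂ x : ι → ℝ, {A | 0 ≤ star x ⬝ᵥ ((A - B) *ᵥ x)} := by
    ext A
    simp [Matrix.posSemidef_iff_dotProduct_mulVec, Matrix.IsHermitian]
  rw [this]
  refine IsClosed.inter (isClosed_eq (by fun_prop) (by fun_prop)) (isClosed_iInter fun x => ?_)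
  exact isClosed_le continuous_const (by fun_prop)

theorem continuousOn_whitenedEvidence {T a c : ℝ} (hT : 0 < T) (hc : 0 ≤ c) (u : κ → ℝ) :
    ContinuousOn (whitenedEvidence T a u) {A | (A - c • 1).PosSemidef} := by
  have hAp : ∀ A ∈ {A : Matrix κ κ ℝ | (A - c • 1).PosSemidef}, A.PosSemidef := by
    intro A hA
    have := Matrix.PosSemidef.add hA (Matrix.PosSemidef.one.smul hc)
    simpa using this
  have hdet : ∀ A ∈ {A : Matrix κ κ ℝ | (A - c • 1).PosSemidef}, (1 + A).det ≠ 0 :=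
    fun A hA => (Matrix.PosDef.one.add_posSemidef (hAp A hA)).det_pos.ne'
  have hcd : Continuous fun A : Matrix κ κ ℝ => (1 + A).det := by fun_prop
  have hinv : ContinuousOn (fun A : Matrix κ κ ℝ => (1 + A)⁻¹)
      {A | (A - c • 1).PosSemidef} := by
    simp only [Matrix.inv_def, Ring.inverse_eq_inv']
    refine ContinuousOn.smul (hcd.continuousOn.inv₀ hdet) (Continuous.continuousOn ?_)
    exact (continuous_const.add continuous_id).matrix_adjugate
  refine ContinuousOn.mul (ContinuousOn.inv₀ (by fun_prop) fun A hA => ?_) ?_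
  · exact (Real.sqrt_pos.mpr (Matrix.PosDef.one.add_posSemidef (hAp A hA)).det_pos).ne'
  · refine ContinuousOn.rpow_const ?_ fun A hA => Or.inl ?_
    · refine continuousOn_const.add ?_
      have : Continuous fun D : Matrix κ κ ℝ => u ⬝ᵥ (D *ᵥ u) := by fun_prop
      exact this.comp_continuousOn hinv
    · have hu := (Matrix.PosDef.one.add_posSemidef (hAp A hA)).inv.posSemidef.dotProduct_mulVec_nonneg u
      simp only [star_trivial] at hu
      linarith

/-- The whitened evidence is continuous and tends to zero as `A ⪰ c I` grows, because the
determinant penalty is unbounded while the residual sum of squares stays above `T > 0`. -/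
theorem exists_isMaxOn_whitenedEvidence {T a c : ℝ} (hT : 0 < T) (ha : 0 ≤ a) (hc : 0 ≤ c)
    (u : κ → ℝ) : ∃ A : Matrix κ κ ℝ, (A - c • 1).PosSemidef ∧
      ∀ A' : Matrix κ κ ℝ, (A' - c • 1).PosSemidef →
        whitenedEvidence T a u A' ≤ whitenedEvidence T a u A := by
  set f₀ := whitenedEvidence T a u (c • 1) with hf₀
  have huu : 0 ≤ u ⬝ᵥ u := by simpa using dotProduct_self_star_nonneg u
  have hf₀pos : 0 < f₀ := by
    rw [hf₀, whitenedEvidence_smul_one hc]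
    positivity
  -- Beyond determinant `R` the evidence is below its value `f₀` at the lower bound `c I`.
  set R := (T ^ (-a) / f₀) ^ 2 with hR
  set s : Set (Matrix κ κ ℝ) := {A | (A - c • 1).PosSemidef} with hs
  set L := max (Fintype.card κ * R) c with hL
  set K : Set (Matrix κ κ ℝ) := {A | ∀ i j, A i j ∈ Set.Icc (-L) L} with hK
  have hKc : IsCompact K := by
    have : K = Set.univ.pi fun _ : κ => Set.univ.pi fun _ : κ => Set.Icc (-L) L := by
      ext A
      exact ⟨fun h i _ j _ => h i j, fun h i j => h i trivial j trivial⟩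
    rw [this]
    exact isCompact_univ_pi fun _ => isCompact_univ_pi fun _ => isCompact_Icc
  have hmem : c • (1 : Matrix κ κ ℝ) ∈ K ∩ s := by
    have hcL : c ≤ L := le_max_right _ _
    refine ⟨fun i j => ?_, ?_⟩
    · rcases eq_or_ne i j with rfl | h
      · simp only [Matrix.smul_apply, Matrix.one_apply_eq, smul_eq_mul, mul_one]
        constructor <;> linarith
      · simp only [Matrix.smul_apply, Matrix.one_apply_ne h, smul_eq_mul, mul_zero]
        constructor <;> linarith
    · simp [hs, Matrix.PosSemidef.zero]
  obtain ⟨A, hA, hmax⟩ := (hKc.inter_right (isClosed_setOf_posSemidef_sub (c • 1))).exists_isMaxOn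
    ⟨_, hmem⟩ ((continuousOn_whitenedEvidence (a := a) hT hc u).mono Set.inter_subset_right)
  refine ⟨A, hA.2, fun A' hA' => ?_⟩
  by_cases hA'K : A' ∈ K
  · exact hmax ⟨hA'K, hA'⟩
  · have hdet : R < (1 + A').det := by
      by_contra! hle
      refine hA'K fun i j => abs_le.mp ?_
      exact (abs_apply_le_of_det_le hc hA' hle i j).trans (le_max_left _ _)
    refine le_trans ?_ (hmax hmem)
    refine (whitenedEvidence_le hT ha hc u hA').trans ?_
    have hTa : 0 < T ^ (-a) := by positivity
    have h1 : T ^ (-a) / f₀ < √(1 + A').det := by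
      refine Real.lt_sqrt_of_sq_lt ?_
      rwa [hR] at hdet
    have h2 : 0 < √(1 + A').det := lt_trans (by positivity) h1
    rw [div_lt_iff₀ hf₀pos] at h1
    change _ ≤ f₀
    rw [inv_mul_le_iff₀ h2]
    exact h1.le

end Whitening

/-! ### Bounds for the restricted maximum of the marginal likelihood -/

section ModelBounds

variable {n p₀ : ℕ} {κ : Type*} [Fintype κ] [DecidableEq κ]
  {X₀ : Matrix (Fin n) (Fin p₀) ℝ} {X : Matrix (Fin n) κ ℝ}

theorem half_sub_nonneg (hn : p₀ < n) : (0 : ℝ) ≤ ((n : ℝ) - p₀) / 2 := by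
  have : (p₀ : ℝ) < n := by exact_mod_cast hn
  linarith

theorem exists_isTypeIIMLCov (h₀ : (X₀ᵀ * X₀).PosDef) (horth : X₀ᵀ * X = 0)
    (hG : (Xᵀ * X).PosDef) (hn : p₀ < n) {y : Fin n → ℝ} (hT : 0 < rss X₀ X y) :
    ∃ W, IsTypeIIMLCov X₀ X y W := by
  obtain ⟨C, hC, hCG⟩ := exists_whitening hG
  have hn0 : (0 : ℝ) < n := by exact_mod_cast (by omega : 0 < n)
  obtain ⟨A, hA, hmax⟩ := exists_isMaxOn_whitenedEvidence hT (half_sub_nonneg hn) hn0.le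
    (Cᵀ *ᵥ (Xᵀ *ᵥ y))
  refine ⟨C * A * Cᵀ, (posSemidef_sub_lowerBound_iff hC hCG).mpr hA, fun W' hW' => ?_⟩
  obtain ⟨A', rfl⟩ := exists_eq_conj hC W'
  rw [posSemidef_sub_lowerBound_iff hC hCG] at hW'
  rw [marginalLikelihood_whitened h₀ horth hC hCG (posDef_of_sub_smul_one hn0 hW') hn hT,
    marginalLikelihood_whitened h₀ horth hC hCG (posDef_of_sub_smul_one hn0 hA) hn hT]
  exact ENNReal.ofReal_le_ofReal
    (mul_le_mul_of_nonneg_left (hmax A' hW') (evidenceConst_pos h₀ hn).le)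

/-- The bound uses `det (1 + A) ≥ (1 + n)^k` and drops the nonnegative term `uᵀ (1 + A)⁻¹ u`. -/
theorem marginalLikelihood_le (h₀ : (X₀ᵀ * X₀).PosDef) (horth : X₀ᵀ * X = 0)
    (hG : (Xᵀ * X).PosDef) (hn : p₀ < n) {y : Fin n → ℝ} (hT : 0 < rss X₀ X y)
    {W : Matrix κ κ ℝ} (hW : (W - lowerBound X).PosSemidef) :
    marginalLikelihood X₀ X W y ≤ ENNReal.ofReal (evidenceConst X₀ *
      ((√((1 + (n : ℝ)) ^ Fintype.card κ))⁻¹ * rss X₀ X y ^ (-(((n : ℝ) - p₀) / 2)))) := by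
  obtain ⟨C, hC, hCG⟩ := exists_whitening hG
  have hn0 : (0 : ℝ) < n := by exact_mod_cast (by omega : 0 < n)
  obtain ⟨A, rfl⟩ := exists_eq_conj hC W
  rw [posSemidef_sub_lowerBound_iff hC hCG] at hW
  rw [marginalLikelihood_whitened h₀ horth hC hCG (posDef_of_sub_smul_one hn0 hW) hn hT]
  refine ENNReal.ofReal_le_ofReal
    (mul_le_mul_of_nonneg_left ?_ (evidenceConst_pos h₀ hn).le)
  refine (whitenedEvidence_le hT (half_sub_nonneg hn) hn0.le _ hW).trans ?_
  refine mul_le_mul_of_nonneg_right ?_ (by positivity)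
  exact inv_anti₀ (by positivity) (Real.sqrt_le_sqrt (pow_le_det_one_add hn0.le hW))

/-- The lower bound `n (XᵀX)⁻¹` is `A = n I` in whitened coordinates. -/
theorem marginalLikelihood_lowerBound (h₀ : (X₀ᵀ * X₀).PosDef) (horth : X₀ᵀ * X = 0)
    (hG : (Xᵀ * X).PosDef) (hn : p₀ < n) {y : Fin n → ℝ} (hT : 0 < rss X₀ X y) :
    marginalLikelihood X₀ X (lowerBound X) y = ENNReal.ofReal (evidenceConst X₀ *
      ((√((1 + (n : ℝ)) ^ Fintype.card κ))⁻¹ *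
        (rss X₀ X y + fitSq X y / (1 + n)) ^ (-(((n : ℝ) - p₀) / 2)))) := by
  obtain ⟨C, hC, hCG⟩ := exists_whitening hG
  have hn0 : (0 : ℝ) < n := by exact_mod_cast (by omega : 0 < n)
  have e : lowerBound X = C * ((n : ℝ) • 1) * Cᵀ := by
    rw [lowerBound, whitening_gram_inv hC hCG]
    simp
  rw [e, marginalLikelihood_whitened h₀ horth hC hCG (Matrix.PosDef.one.smul hn0) hn hT,
    whitenedEvidence_smul_one hn0.le, fitSq_eq_whitened hC hCG]

/-- These two properties of `Ŵ` hold whether or not a maximizer exists, because the fallback value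
is the lower bound. -/
theorem typeIIMLCov_spec (X₀ : Matrix (Fin n) (Fin p₀) ℝ) (X : Matrix (Fin n) κ ℝ)
    (y : Fin n → ℝ) :
    (typeIIMLCov X₀ X y - lowerBound X).PosSemidef ∧
      marginalLikelihood X₀ X (lowerBound X) y ≤
        marginalLikelihood X₀ X (typeIIMLCov X₀ X y) y := by
  have h0 : (lowerBound X - lowerBound X).PosSemidef := by
    rw [sub_self]
    exact Matrix.PosSemidef.zero
  unfold typeIIMLCov
  split_ifs with h
  · exact ⟨h.choose_spec.1, h.choose_spec.2 _ h0⟩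
  · exact ⟨h0, le_rfl⟩

end ModelBounds

/-! ### Projections and sums of squares -/

section LeastSquares

variable {n p₀ : ℕ} {κ : Type*} [Fintype κ] [DecidableEq κ]
  {X₀ : Matrix (Fin n) (Fin p₀) ℝ} {X : Matrix (Fin n) κ ℝ}

theorem fitSq_eq_proj (X : Matrix (Fin n) κ ℝ) (y : Fin n → ℝ) :
    fitSq X y = y ⬝ᵥ (proj X *ᵥ y) := by
  rw [fitSq, proj, ← Matrix.mulVec_mulVec, ← Matrix.mulVec_mulVec, Matrix.dotProduct_mulVec y X,
    Matrix.mulVec_transpose]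

theorem proj_transpose (X : Matrix (Fin n) κ ℝ) : (proj X)ᵀ = proj X := by
  rw [proj, Matrix.transpose_mul, Matrix.transpose_mul, Matrix.transpose_transpose,
    Matrix.transpose_nonsing_inv, Matrix.transpose_mul, Matrix.transpose_transpose,
    Matrix.mul_assoc]

theorem proj_mul_self_design (hG : (Xᵀ * X).PosDef) : proj X * X = X := by
  rw [proj, Matrix.mul_assoc, Matrix.mul_assoc, Matrix.nonsing_inv_mul _ (posDef_isUnit_det hG),
    Matrix.mul_one]

theorem proj_mul_proj (hG : (Xᵀ * X).PosDef) : proj X * proj X = proj X := by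
  nth_rewrite 2 [proj]
  rw [← Matrix.mul_assoc, ← Matrix.mul_assoc, proj_mul_self_design hG, proj]

theorem trace_proj (hG : (Xᵀ * X).PosDef) : (proj X).trace = Fintype.card κ := by
  rw [proj, Matrix.trace_mul_comm, ← Matrix.mul_assoc,
    Matrix.mul_nonsing_inv _ (posDef_isUnit_det hG), Matrix.trace_one]

theorem fitSq_eq_sq (hG : (Xᵀ * X).PosDef) (y : Fin n → ℝ) :
    fitSq X y = (proj X *ᵥ y) ⬝ᵥ (proj X *ᵥ y) := by
  rw [fitSq_eq_proj, Matrix.dotProduct_mulVec (proj X *ᵥ y), ← Matrix.mulVec_transpose,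
    proj_transpose, Matrix.mulVec_mulVec, proj_mul_proj hG, dotProduct_comm]

theorem zero_le_dotProduct_self {ι : Type*} [Fintype ι] (x : ι → ℝ) : 0 ≤ x ⬝ᵥ x := by
  simpa using dotProduct_self_star_nonneg x

theorem fitSq_nonneg (hG : (Xᵀ * X).PosDef) (y : Fin n → ℝ) : 0 ≤ fitSq X y := by
  rw [fitSq_eq_sq hG]
  exact zero_le_dotProduct_self _

theorem fitSq_add_le (hG : (Xᵀ * X).PosDef) (x y : Fin n → ℝ) :
    fitSq X (x + y) ≤ 2 * fitSq X x + 2 * fitSq X y := by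
  have h := zero_le_dotProduct_self (proj X *ᵥ x - proj X *ᵥ y)
  simp only [fitSq_eq_sq hG, Matrix.mulVec_add, add_dotProduct, dotProduct_add, sub_dotProduct,
    dotProduct_sub] at h ⊢
  linarith

theorem proj_mul_proj_of_orth (horth : X₀ᵀ * X = 0) : proj X₀ * proj X = 0 := by
  rw [proj, proj, Matrix.mul_assoc, ← Matrix.mul_assoc X₀ᵀ, ← Matrix.mul_assoc X₀ᵀ, horth]
  simp

/-- `1 - P₀ - P` is the orthogonal projection onto the complement of both column spaces. -/
theorem rss_eq_sq (h₀ : (X₀ᵀ * X₀).PosDef) (horth : X₀ᵀ * X = 0) (hG : (Xᵀ * X).PosDef)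
    (y : Fin n → ℝ) :
    rss X₀ X y = ((1 - proj X₀ - proj X) *ᵥ y) ⬝ᵥ ((1 - proj X₀ - proj X) *ᵥ y) := by
  have h1 := proj_mul_proj_of_orth horth
  have h2 : proj X * proj X₀ = 0 := by
    have := congrArg Matrix.transpose h1
    rwa [Matrix.transpose_mul, proj_transpose, proj_transpose, Matrix.transpose_zero] at this
  have ht : (1 - proj X₀ - proj X)ᵀ = 1 - proj X₀ - proj X := by
    rw [Matrix.transpose_sub, Matrix.transpose_sub, proj_transpose, proj_transpose,
      Matrix.transpose_one]
  have hsq : (1 - proj X₀ - proj X) * (1 - proj X₀ - proj X) = 1 - proj X₀ - proj X := by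
    simp only [Matrix.mul_sub, Matrix.sub_mul, Matrix.one_mul, Matrix.mul_one, h1, h2,
      proj_mul_proj h₀, proj_mul_proj hG]
    simp
  rw [Matrix.dotProduct_mulVec (_ *ᵥ y), ← Matrix.mulVec_transpose, ht, Matrix.mulVec_mulVec, hsq,
    dotProduct_comm, rss, fitSq_eq_proj, fitSq_eq_proj, Matrix.sub_mulVec, Matrix.sub_mulVec,
    Matrix.one_mulVec, dotProduct_sub, dotProduct_sub]

/-- When the degrees of freedom `n - p₀ - k` are positive, the projection onto the orthogonal
complement of the design has positive trace, hence a nonzero row. -/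
theorem exists_row_ne_zero (h₀ : (X₀ᵀ * X₀).PosDef) (hG : (Xᵀ * X).PosDef)
    (hn : p₀ + Fintype.card κ < n) : ∃ i, (1 - proj X₀ - proj X) i ≠ 0 := by
  by_contra! h
  have h0 : 1 - proj X₀ - proj X = 0 := by
    ext i j
    rw [h i]
    rfl
  have := congrArg Matrix.trace h0
  rw [Matrix.trace_sub, Matrix.trace_sub, trace_proj h₀, trace_proj hG, Matrix.trace_one,
    Matrix.trace_zero, Fintype.card_fin, Fintype.card_fin] at this
  have h2 : ((p₀ + Fintype.card κ : ℕ) : ℝ) < n := by exact_mod_cast hn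
  push_cast at h2
  linarith

theorem rss_add_common (h₀ : (X₀ᵀ * X₀).PosDef) (horth : X₀ᵀ * X = 0) (hG : (Xᵀ * X).PosDef)
    (b : Fin p₀ → ℝ) (y : Fin n → ℝ) : rss X₀ X (X₀ *ᵥ b + y) = rss X₀ X y := by
  have hX : Xᵀ * X₀ = 0 := by rw [← Matrix.transpose_transpose (Xᵀ * X₀)]; simp [horth]
  have e : (1 - proj X₀ - proj X) *ᵥ (X₀ *ᵥ b) = 0 := by
    rw [Matrix.mulVec_mulVec, Matrix.sub_mul, Matrix.sub_mul, proj_mul_self_design h₀,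
      Matrix.one_mul, proj, Matrix.mul_assoc _ Xᵀ, hX]
    simp
  rw [rss_eq_sq h₀ horth hG, rss_eq_sq h₀ horth hG, Matrix.mulVec_add, e, zero_add]

theorem fitSq_add_common (horth : X₀ᵀ * X = 0) (b : Fin p₀ → ℝ) (y : Fin n → ℝ) :
    fitSq X (X₀ *ᵥ b + y) = fitSq X y := by
  have hX : Xᵀ * X₀ = 0 := by rw [← Matrix.transpose_transpose (Xᵀ * X₀)]; simp [horth]
  have e : Xᵀ *ᵥ (X₀ *ᵥ b + y) = Xᵀ *ᵥ y := by
    rw [Matrix.mulVec_add, Matrix.mulVec_mulVec, hX, Matrix.zero_mulVec, zero_add]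
  rw [fitSq, fitSq, e]

/-- The residual sum of squares of signal `μ` plus noise `e`. -/
theorem rss_add_eq {μ : Fin n → ℝ} (hμ : X₀ᵀ *ᵥ μ = 0) (e : Fin n → ℝ) :
    rss X₀ X (μ + e) = μ ⬝ᵥ ((1 - proj X) *ᵥ μ) + 2 * (((1 - proj X) *ᵥ μ) ⬝ᵥ e) + e ⬝ᵥ e -
      fitSq X₀ e - fitSq X e := by
  have e1 : fitSq X₀ (μ + e) = fitSq X₀ e := by
    rw [fitSq, fitSq, Matrix.mulVec_add, hμ, zero_add]
  have e2 : e ⬝ᵥ (proj X *ᵥ μ) = μ ⬝ᵥ (proj X *ᵥ e) := by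
    rw [Matrix.dotProduct_mulVec, ← Matrix.mulVec_transpose, proj_transpose, dotProduct_comm]
  rw [rss, e1, fitSq_eq_proj X, fitSq_eq_proj X]
  simp only [Matrix.mulVec_add, Matrix.sub_mulVec, Matrix.one_mulVec, add_dotProduct,
    dotProduct_add, sub_dotProduct, dotProduct_sub]
  rw [e2, dotProduct_comm (proj X *ᵥ μ) e, e2, dotProduct_comm e μ]
  ring

theorem residual_sq_eq (hG : (Xᵀ * X).PosDef) (μ : Fin n → ℝ) :
    ((1 - proj X) *ᵥ μ) ⬝ᵥ ((1 - proj X) *ᵥ μ) = μ ⬝ᵥ ((1 - proj X) *ᵥ μ) := by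
  have h := fitSq_eq_sq hG μ
  rw [fitSq_eq_proj] at h
  simp only [Matrix.sub_mulVec, Matrix.one_mulVec, sub_dotProduct, dotProduct_sub]
  rw [dotProduct_comm (proj X *ᵥ μ) μ, ← h]
  ring

end LeastSquares

/-! ### Design matrices of the models -/

section Designs

variable {n p₀ p : ℕ} {X₀ : Matrix (Fin n) (Fin p₀) ℝ} {X : Matrix (Fin n) (Fin p) ℝ}

theorem posDef_gram_of_linearIndependent {κ : Type*} [Fintype κ] {Z : Matrix (Fin n) κ ℝ}
    (h : LinearIndependent ℝ Z.col) : (Zᵀ * Z).PosDef := by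
  rw [← Matrix.conjTranspose_eq_transpose_of_trivial]
  exact Matrix.PosDef.conjTranspose_mul_self Z (Matrix.mulVec_injective_iff.mpr h)

theorem posDef_gram_common (h : LinearIndependent ℝ (Matrix.fromCols X₀ X).col) :
    (X₀ᵀ * X₀).PosDef :=
  posDef_gram_of_linearIndependent (h.comp Sum.inl Sum.inl_injective)

theorem posDef_gram_modelDesign (h : LinearIndependent ℝ (Matrix.fromCols X₀ X).col)
    (γ : Finset (Fin p)) : ((modelDesign X γ)ᵀ * modelDesign X γ).PosDef :=
  posDef_gram_of_linearIndependent
    (h.comp (fun j : γ => Sum.inr j.1) (Sum.inr_injective.comp Subtype.val_injective))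

theorem orth_modelDesign (h : X₀ᵀ * X = 0) (γ : Finset (Fin p)) :
    X₀ᵀ * modelDesign X γ = 0 := by
  ext i j
  exact congrFun (congrFun h i) j.1

/-- The mean of a model is fitted without residual by every model that nests it. -/
theorem residual_modelDesign_eq_zero {γs γ : Finset (Fin p)} (hsub : γs ⊆ γ)
    (hG : ((modelDesign X γ)ᵀ * modelDesign X γ).PosDef) (b : γs → ℝ) :
    (1 - proj (modelDesign X γ)) *ᵥ (modelDesign X γs *ᵥ b) = 0 := by
  have e : modelDesign X γs *ᵥ b =
      modelDesign X γ *ᵥ (fun j => if h : j.1 ∈ γs then b ⟨j.1, h⟩ else 0) := by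
    ext i
    simp only [Matrix.mulVec, dotProduct, modelDesign, Matrix.submatrix_apply, id]
    rw [Finset.sum_coe_sort_eq_attach, Finset.sum_coe_sort_eq_attach]
    let F : Fin p → ℝ := fun j => X i j * (if h : j ∈ γs then b ⟨j, h⟩ else 0)
    have e1 : ∑ j ∈ γs.attach, X i j.1 * b j = ∑ j ∈ γs, F j := by
      rw [← Finset.sum_attach γs F]
      exact Finset.sum_congr rfl fun j _ => by simp [F]
    rw [e1, Finset.sum_attach γ F]
    refine Finset.sum_subset hsub fun j _ hj => by simp [F, hj]
  rw [e, Matrix.mulVec_mulVec, Matrix.sub_mul, proj_mul_self_design hG, Matrix.one_mul, sub_self,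
    Matrix.zero_mulVec]

theorem common_transpose_mulVec_mean (h : X₀ᵀ * X = 0) (γ : Finset (Fin p)) (b : γ → ℝ) :
    X₀ᵀ *ᵥ (modelDesign X γ *ᵥ b) = 0 := by
  rw [Matrix.mulVec_mulVec, orth_modelDesign h, Matrix.zero_mulVec]

end Designs

/-! ### White noise -/

section Noise

variable {Ω : Type*} [MeasurableSpace Ω] {P : Measure Ω} {n : ℕ}
  {e : Ω → Fin n → ℝ} {σsq : ℝ≥0}

theorem noise_memLp (he : ∀ i, HasLaw (fun ω => e ω i) (gaussianReal 0 σsq) P) (i : Fin n)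
    {q : ℝ≥0∞} (hq : q ≠ ∞) : MemLp (fun ω => e ω i) q P :=
  (he i).hasGaussianLaw.memLp hq

theorem noise_integral (he : ∀ i, HasLaw (fun ω => e ω i) (gaussianReal 0 σsq) P) (i : Fin n) :
    ∫ ω, e ω i ∂P = 0 := by
  rw [(he i).integral_eq]
  exact integral_id_gaussianReal

theorem noise_integral_sq (he : ∀ i, HasLaw (fun ω => e ω i) (gaussianReal 0 σsq) P)
    (i : Fin n) : ∫ ω, e ω i * e ω i ∂P = σsq := by
  have h1 : Var[fun ω => e ω i; P] = σsq := by
    rw [(he i).variance_eq]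
    exact variance_id_gaussianReal
  rw [variance_of_integral_eq_zero (he i).aemeasurable (noise_integral he i)] at h1
  simpa only [sq] using h1

/-- Quadratic forms in white noise: only the second moments matter. -/
theorem noise_integral_quadForm (he : ∀ i, HasLaw (fun ω => e ω i) (gaussianReal 0 σsq) P)
    (hind : iIndepFun (fun i ω => e ω i) P) (M : Matrix (Fin n) (Fin n) ℝ) :
    Integrable (fun ω => e ω ⬝ᵥ (M *ᵥ e ω)) P ∧
      ∫ ω, e ω ⬝ᵥ (M *ᵥ e ω) ∂P = σsq * M.trace := by
  have hint : ∀ i j, Integrable (fun ω => e ω i * e ω j) P := fun i j =>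
    (noise_memLp he i (by simp : (2 : ℝ≥0∞) ≠ ∞)).integrable_mul
      (noise_memLp he j (by simp : (2 : ℝ≥0∞) ≠ ∞))
  have hcov : ∀ i j, ∫ ω, e ω i * e ω j ∂P = if i = j then (σsq : ℝ) else 0 := by
    intro i j
    split_ifs with h
    · subst h
      exact noise_integral_sq he i
    · have := (hind.indepFun h).integral_fun_mul_eq_mul_integral
        (he i).aemeasurable.aestronglyMeasurable (he j).aemeasurable.aestronglyMeasurable
      rw [this, noise_integral he i, zero_mul]
  have hexp : ∀ ω, e ω ⬝ᵥ (M *ᵥ e ω) = ∑ i, ∑ j, M i j * (e ω i * e ω j) := by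
    intro ω
    simp only [dotProduct, Matrix.mulVec, Finset.mul_sum]
    exact Finset.sum_congr rfl fun i _ => Finset.sum_congr rfl fun j _ => by ring
  simp only [hexp]
  refine ⟨integrable_finsetSum _ fun i _ => integrable_finsetSum _ fun j _ =>
    (hint i j).const_mul _, ?_⟩
  calc ∫ ω, ∑ i, ∑ j, M i j * (e ω i * e ω j) ∂P
      = ∑ i, ∑ j, ∫ ω, M i j * (e ω i * e ω j) ∂P := by
        refine (integral_finsetSum _ fun i _ => integrable_finsetSum _ fun j _ =>
          (hint i j).const_mul _).trans (Finset.sum_congr rfl fun i _ => ?_)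
        exact integral_finsetSum _ fun j _ => (hint i j).const_mul _
    _ = ∑ i, ∑ j, M i j * (if i = j then (σsq : ℝ) else 0) := by
        refine Finset.sum_congr rfl fun i _ => Finset.sum_congr rfl fun j _ => ?_
        rw [integral_const_mul, hcov]
    _ = σsq * M.trace := by
        simp [Matrix.trace, Finset.mul_sum, mul_comm]

theorem noise_fitSq (he : ∀ i, HasLaw (fun ω => e ω i) (gaussianReal 0 σsq) P)
    (hind : iIndepFun (fun i ω => e ω i) P) {κ : Type*} [Fintype κ] [DecidableEq κ]
    {X : Matrix (Fin n) κ ℝ} (hG : (Xᵀ * X).PosDef) :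
    Integrable (fun ω => fitSq X (e ω)) P ∧
      ∫ ω, fitSq X (e ω) ∂P = σsq * Fintype.card κ := by
  simp only [fitSq_eq_proj]
  rw [← trace_proj hG]
  exact noise_integral_quadForm he hind _

theorem noise_linear (he : ∀ i, HasLaw (fun ω => e ω i) (gaussianReal 0 σsq) P)
    (hind : iIndepFun (fun i ω => e ω i) P) (a : Fin n → ℝ) :
    Integrable (fun ω => (a ⬝ᵥ e ω) ^ 2) P ∧
      ∫ ω, (a ⬝ᵥ e ω) ^ 2 ∂P = σsq * (a ⬝ᵥ a) := by
  have h : ∀ ω, (a ⬝ᵥ e ω) ^ 2 = e ω ⬝ᵥ (Matrix.vecMulVec a a *ᵥ e ω) := by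
    intro ω
    rw [Matrix.vecMulVec_mulVec, dotProduct_smul, dotProduct_comm (e ω) a]
    simp [sq]
  simp only [h]
  rw [← Matrix.trace_vecMulVec]
  exact noise_integral_quadForm he hind _

theorem noise_linear_tail (he : ∀ i, HasLaw (fun ω => e ω i) (gaussianReal 0 σsq) P)
    (hind : iIndepFun (fun i ω => e ω i) P) (a : Fin n → ℝ) {t : ℝ} (ht : 0 < t) :
    P.real {ω | t ≤ |a ⬝ᵥ e ω|} ≤ σsq * (a ⬝ᵥ a) / t ^ 2 := by
  obtain ⟨h1, h2⟩ := noise_linear he hind a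
  have h3 := mul_meas_ge_le_integral_of_nonneg (Eventually.of_forall fun ω => sq_nonneg _) h1
    (t ^ 2)
  rw [h2] at h3
  have h4 : {ω | t ≤ |a ⬝ᵥ e ω|} = {ω | t ^ 2 ≤ (a ⬝ᵥ e ω) ^ 2} := by
    ext ω
    change t ≤ |a ⬝ᵥ e ω| ↔ t ^ 2 ≤ (a ⬝ᵥ e ω) ^ 2
    rw [sq_le_sq, abs_of_pos ht]
  rw [h4, le_div_iff₀ (by positivity), mul_comm]
  exact h3

/-- A nonzero linear functional of the noise has a nondegenerate normal law, hence no atoms. -/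
theorem noise_linear_ne (hσ : 0 < σsq)
    (he : ∀ i, HasLaw (fun ω => e ω i) (gaussianReal 0 σsq) P)
    (hind : iIndepFun (fun i ω => e ω i) P) {a : Fin n → ℝ} (ha : a ≠ 0) (c : ℝ) :
    ∀ᵐ ω ∂P, a ⬝ᵥ e ω ≠ c := by
  have hlaw : HasGaussianLaw (fun ω => a ⬝ᵥ e ω) P := by
    have := iIndepFun.hasGaussianLaw_fun_sum (X := fun i ω => a i * e ω i) (P := P)
      (fun i => (he i).hasGaussianLaw.fun_smul (a i))
      (hind.comp (fun i x => a i * x) fun i => by fun_prop)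
    exact this
  have hmean : ∫ ω, a ⬝ᵥ e ω ∂P = 0 := by
    simp only [dotProduct]
    rw [integral_finsetSum _ fun i _ => ((he i).hasGaussianLaw.integrable).const_mul _]
    simp [integral_const_mul, noise_integral he]
  have hvar : Var[fun ω => a ⬝ᵥ e ω; P] = σsq * (a ⬝ᵥ a) := by
    rw [variance_of_integral_eq_zero hlaw.aemeasurable hmean]
    exact (noise_linear he hind a).2
  have haa : 0 < a ⬝ᵥ a :=
    lt_of_le_of_ne (zero_le_dotProduct_self a) fun h => ha (dotProduct_self_eq_zero.mp h.symm)
  have hmap := hlaw.map_eq_gaussianReal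
  have hne : (Var[fun ω => a ⬝ᵥ e ω; P]).toNNReal ≠ 0 := by
    rw [hvar]
    have : 0 < (σsq : ℝ) := hσ
    simpa using by positivity
  have hnull := nullSingletonClass_gaussianReal (μ := ∫ ω, a ⬝ᵥ e ω ∂P) hne
  have h0 : P.map (fun ω => a ⬝ᵥ e ω) {c} = 0 := by
    rw [hmap]
    exact measure_singleton c
  rw [Measure.map_apply_of_aemeasurable hlaw.aemeasurable (measurableSet_singleton c)] at h0
  rw [ae_iff]
  simpa [Set.preimage] using h0

/-- Chebyshev's inequality for the squared length of the noise. The constant is the variance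
of the square of one coordinate. -/
theorem noise_sq_tail [IsProbabilityMeasure P]
    (he : ∀ i, HasLaw (fun ω => e ω i) (gaussianReal 0 σsq) P)
    (hind : iIndepFun (fun i ω => e ω i) P) {t : ℝ} (ht : 0 < t) :
    P.real {ω | t ≤ |e ω ⬝ᵥ e ω - n * σsq|} ≤
      n * Var[fun x => x ^ 2; gaussianReal 0 σsq] / t ^ 2 := by
  have hmem : ∀ i, MemLp (fun ω => e ω i ^ 2) 2 P := by
    intro i
    have h4 := noise_memLp he i (by simp : (4 : ℝ≥0∞) ≠ ∞)
    have : ENNReal.HolderTriple 4 4 2 := ⟨by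
      rw [← two_mul, show (4 : ℝ≥0∞) = 2 * 2 by norm_num,
        ENNReal.mul_inv (Or.inl (by simp)) (Or.inl (by simp)), ← mul_assoc,
        ENNReal.mul_inv_cancel (by simp) (by simp), one_mul]⟩
    have := h4.mul (r := 2) h4
    refine this.congr_norm ?_ ?_
    · exact ((he i).aemeasurable.pow_const 2).aestronglyMeasurable
    · exact Eventually.of_forall fun ω => by simp [sq]
  have hvar : Var[∑ i, fun ω => e ω i ^ 2; P] = n * Var[fun x => x ^ 2; gaussianReal 0 σsq] := by
    rw [IndepFun.variance_sum (fun i _ => hmem i)]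
    · have : ∀ i, Var[fun ω => e ω i ^ 2; P] = Var[fun x => x ^ 2; gaussianReal 0 σsq] := by
        intro i
        rw [← (he i).map_eq, variance_map (by fun_prop) (he i).aemeasurable]
        rfl
      simp [this]
    · intro i _ j _ hij
      exact (hind.indepFun hij).comp (φ := fun x => x ^ 2) (ψ := fun x => x ^ 2)
        (by fun_prop) (by fun_prop)
  have hsum : ∀ ω, (∑ i, fun ω => e ω i ^ 2) ω = e ω ⬝ᵥ e ω := by
    intro ω
    simp [dotProduct, sq]
  have hmean : ∫ ω, (∑ i, fun ω => e ω i ^ 2) ω ∂P = n * σsq := by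
    simp only [hsum]
    have := (noise_integral_quadForm he hind 1).2
    simp only [Matrix.one_mulVec, Matrix.trace_one, Fintype.card_fin] at this
    rw [this, mul_comm]
  have h := meas_ge_le_variance_div_sq (memLp_finsetSum' Finset.univ fun i _ => hmem i) ht
  rw [hmean, hvar] at h
  simp only [hsum] at h
  refine ENNReal.toReal_le_of_le_ofReal ?_ h
  have := variance_nonneg (fun x : ℝ => x ^ 2) (gaussianReal 0 σsq)
  positivity

end Noise

/-! ### Comparison of evidences for large samples -/

section Comparison

/-- The comparison of evidences reduces to one of the ratio of sums of squares. -/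
theorem evidence_le_of_ratio_le {x a η T N ρ : ℝ} {k l : ℕ} (hx : 0 < x) (ha : 0 ≤ a)
    (hT : 0 < T) (hN : 0 < N) (hρ : N / T ≤ Real.exp ρ)
    (h : √(x ^ l) * Real.exp (ρ * a) ≤ η * √(x ^ k)) :
    (√(x ^ k))⁻¹ * T ^ (-a) ≤ η * ((√(x ^ l))⁻¹ * N ^ (-a)) := by
  have h1 : (N / T) ^ a ≤ Real.exp (ρ * a) := by
    rw [Real.exp_mul]
    exact Real.rpow_le_rpow (by positivity) hρ ha
  rw [Real.div_rpow hN.le hT.le] at h1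
  rw [Real.rpow_neg hT.le, Real.rpow_neg hN.le]
  have hk : 0 < √(x ^ k) := by positivity
  have hl : 0 < √(x ^ l) := by positivity
  have hTa : 0 < T ^ a := by positivity
  have hNa : 0 < N ^ a := by positivity
  have h2 : √(x ^ l) * (N ^ a / T ^ a) ≤ η * √(x ^ k) :=
    le_trans (mul_le_mul_of_nonneg_left h1 hl.le) h
  calc (√(x ^ k))⁻¹ * (T ^ a)⁻¹
      = (√(x ^ l) * (N ^ a / T ^ a)) * ((√(x ^ k))⁻¹ * (√(x ^ l))⁻¹ * (N ^ a)⁻¹) := by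
        field_simp
    _ ≤ (η * √(x ^ k)) * ((√(x ^ k))⁻¹ * (√(x ^ l))⁻¹ * (N ^ a)⁻¹) :=
        mul_le_mul_of_nonneg_right h2 (by positivity)
    _ = _ := by field_simp

/-- Overfitting: an extra parameter costs a factor `√(1 + n)`, while the likelihood ratio stays
bounded. -/
theorem eventually_evidence_le_of_nested (p₀ : ℕ) {c M C η : ℝ} (hc : 0 < c) (hM : 0 ≤ M)
    (hC : 0 ≤ C) (hη : 0 < η) :
    ∀ᶠ n : ℕ in atTop, ∀ (k l : ℕ) (Q T N : ℝ), l < k → c * n ≤ Q → Q - M ≤ T → 0 < N →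
      N ≤ Q + C → 0 < T ∧ (√((1 + (n : ℝ)) ^ k))⁻¹ * T ^ (-(((n : ℝ) - p₀) / 2)) ≤
        η * ((√((1 + (n : ℝ)) ^ l))⁻¹ * N ^ (-(((n : ℝ) - p₀) / 2))) := by
  have hlim : Tendsto (fun n : ℕ => (n : ℝ)) atTop atTop := tendsto_natCast_atTop_atTop
  filter_upwards [hlim.eventually_ge_atTop (max 1 (2 * M / c)),
    hlim.eventually_ge_atTop ((Real.exp ((C + M) / c) / η) ^ 2), eventually_gt_atTop p₀]
    with n hn1 hn2 hn3 k l Q T N hlk hQ hT hN hNQ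
  have hn0 : (0 : ℝ) < n := lt_of_lt_of_le one_pos ((le_max_left _ _).trans hn1)
  have hMn : M ≤ c * n / 2 := by
    have := (le_max_right _ _).trans hn1
    rw [div_le_iff₀ hc] at this
    linarith
  have hcn : 0 < c * n := by positivity
  have hTlow : c * n / 2 ≤ T := by linarith
  have hTpos : 0 < T := by linarith
  have hp : (0 : ℝ) ≤ p₀ := by positivity
  refine ⟨hTpos, evidence_le_of_ratio_le (ρ := (C + M) / (c * n / 2)) (by positivity)
    (half_sub_nonneg hn3) hTpos hN ?_ ?_⟩
  · refine le_trans ?_ (Real.add_one_le_exp _)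
    rw [div_le_iff₀ hTpos]
    have h1 : C + M ≤ (C + M) / (c * n / 2) * T := by
      rw [div_mul_eq_mul_div, le_div_iff₀ (by positivity)]
      exact mul_le_mul_of_nonneg_left hTlow (by positivity)
    linarith
  · have hexp : (C + M) / (c * n / 2) * (((n : ℝ) - p₀) / 2) ≤ (C + M) / c := by
      have : (C + M) / c = (C + M) / (c * n / 2) * ((n : ℝ) / 2) := by field_simp
      rw [this]
      exact mul_le_mul_of_nonneg_left (by linarith) (by positivity)
    have h2 : Real.exp ((C + M) / c) ≤ η * √(1 + n) := by
      rw [← div_le_iff₀' hη]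
      exact Real.le_sqrt_of_sq_le (by linarith)
    calc √((1 + (n : ℝ)) ^ l) * Real.exp ((C + M) / (c * n / 2) * (((n : ℝ) - p₀) / 2))
        ≤ √((1 + (n : ℝ)) ^ l) * (η * √(1 + n)) :=
          mul_le_mul_of_nonneg_left ((Real.exp_le_exp.mpr hexp).trans h2) (by positivity)
      _ = η * √((1 + (n : ℝ)) ^ (l + 1)) := by
          rw [pow_succ, Real.sqrt_mul (by positivity)]
          ring
      _ ≤ η * √((1 + (n : ℝ)) ^ k) := by
          refine mul_le_mul_of_nonneg_left (Real.sqrt_le_sqrt ?_) hη.le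
          exact pow_le_pow_right₀ (by linarith) hlk

/-- Underfitting: a residual sum of squares larger by a term of order `n` makes the likelihood
ratio exponentially small, which beats every power of `1 + n`. -/
theorem eventually_evidence_le_of_not_nested (p₀ p : ℕ) {b D C η : ℝ} (hb : 0 < b) (hD : 0 ≤ D)
    (hη : 0 < η) :
    ∀ᶠ n : ℕ in atTop, ∀ (k l : ℕ) (Q T N : ℝ), l ≤ p → 0 ≤ Q → Q ≤ D * n →
      Q + b * n ≤ T → 0 < N → N ≤ Q + C →
      0 < T ∧ (√((1 + (n : ℝ)) ^ k))⁻¹ * T ^ (-(((n : ℝ) - p₀) / 2)) ≤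
        η * ((√((1 + (n : ℝ)) ^ l))⁻¹ * N ^ (-(((n : ℝ) - p₀) / 2))) := by
  have hlim : Tendsto (fun n : ℕ => (n : ℝ)) atTop atTop := tendsto_natCast_atTop_atTop
  set δ := (b / 2) / (D + b) with hδ
  have hδpos : 0 < δ := by positivity
  have hlim2 : Tendsto (fun n : ℕ => (1 + (n : ℝ)) ^ p * Real.exp (-(δ / 4) * (1 + n)))
      atTop (𝓝 0) := by
    have h1 := (Real.tendsto_pow_mul_exp_neg_atTop_nhds_zero p).comp
      (Tendsto.const_mul_atTop (by positivity : 0 < δ / 4) (tendsto_atTop_add_const_left _ 1 hlim))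
    have h2 := h1.const_mul ((δ / 4)⁻¹ ^ p)
    rw [mul_zero] at h2
    refine h2.congr fun n => ?_
    simp only [Function.comp]
    rw [← mul_assoc, ← mul_pow, inv_mul_cancel_left₀ (by positivity), neg_mul]
  filter_upwards [hlim.eventually_ge_atTop (2 * C / b), hlim.eventually_ge_atTop (2 * p₀ + 1),
    eventually_gt_atTop p₀, hlim2.eventually_le_const (u := η) (by positivity)]
    with n hn1 hn2 hn3 hn4 k l Q T N hlp hQ0 hQ hT hN hNQ
  have hp : (0 : ℝ) ≤ p₀ := by positivity
  have hn0 : (0 : ℝ) < n := by linarith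
  have hCn : C ≤ b * n / 2 := by
    rw [div_le_iff₀ hb] at hn1
    linarith
  have hbn : 0 < b * n := by positivity
  have hTpos : 0 < T := by linarith
  refine ⟨hTpos, evidence_le_of_ratio_le (ρ := -δ) (by positivity)
    (half_sub_nonneg hn3) hTpos hN ?_ ?_⟩
  · refine le_trans ?_ (Real.add_one_le_exp _)
    have hD' : 0 < D + b := by linarith
    have hδ1 : δ * (D + b) = b / 2 := by rw [hδ]; field_simp
    have hδle : δ ≤ 1 := by
      rw [hδ, div_le_one hD']
      linarith
    -- `(Q + bn/2) / (Q + bn)` increases in `Q`, and equals `1 - δ` at `Q = D n`.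
    have h2 : Q + b * n / 2 ≤ (1 - δ) * (Q + b * n) := by
      have h3 : δ * (Q + b * n) ≤ δ * ((D + b) * n) :=
        mul_le_mul_of_nonneg_left (by linarith) hδpos.le
      have h4 : δ * ((D + b) * n) = b * n / 2 := by rw [← mul_assoc, hδ1]; ring
      linarith
    have h5 : (1 - δ) * (Q + b * n) ≤ (1 - δ) * T :=
      mul_le_mul_of_nonneg_left hT (by linarith)
    rw [div_le_iff₀ hTpos]
    linarith
  · have hexp : Real.exp (-δ * (((n : ℝ) - p₀) / 2)) ≤ Real.exp (-(δ / 4) * (1 + n)) * 1 := by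
      rw [mul_one]
      refine Real.exp_le_exp.mpr ?_
      have : δ * ((1 + (n : ℝ)) / 4) ≤ δ * (((n : ℝ) - p₀) / 2) :=
        mul_le_mul_of_nonneg_left (by linarith) hδpos.le
      linarith
    have h1 : (1 : ℝ) ≤ 1 + n := by linarith
    have hsl : √((1 + (n : ℝ)) ^ l) ≤ (1 + (n : ℝ)) ^ p := by
      refine (Real.sqrt_le_sqrt (pow_le_pow_right₀ h1 hlp)).trans ?_
      exact Real.sqrt_le_iff.mpr ⟨by positivity, le_self_pow₀ (one_le_pow₀ h1) two_ne_zero⟩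
    have hsk : 1 ≤ √((1 + (n : ℝ)) ^ k) := Real.one_le_sqrt.mpr (one_le_pow₀ h1)
    rw [mul_one] at hexp
    calc √((1 + (n : ℝ)) ^ l) * Real.exp (-δ * (((n : ℝ) - p₀) / 2))
        ≤ (1 + (n : ℝ)) ^ p * Real.exp (-(δ / 4) * (1 + n)) := by gcongr
      _ ≤ η := hn4
      _ ≤ η * √((1 + (n : ℝ)) ^ k) := le_mul_of_one_le_right hη.le hsk

/-- If every competing evidence is at most `η` times the evidence `m i₀`, then the posterior
probability of `i₀` differs from one by at most `η / w i₀`. -/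
theorem abs_posterior_sub_one_le {ι : Type*} [Fintype ι] [DecidableEq ι] {w : ι → ℝ≥0}
    (hw : ∑ i, w i = 1) {m : ι → ℝ≥0∞} {i₀ : ι} (hw₀ : 0 < w i₀) (hm₀ : m i₀ ≠ 0)
    (hm : ∀ i, m i ≠ ∞) {η : ℝ} (hη : 0 ≤ η)
    (h : ∀ i, i ≠ i₀ → (m i).toReal ≤ η * (m i₀).toReal) :
    |((w i₀ * m i₀) / ∑ i, w i * m i).toReal - 1| ≤ η / w i₀ := by
  have hfin : ∀ i, (w i : ℝ≥0∞) * m i ≠ ∞ := fun i => ENNReal.mul_ne_top (by simp) (hm i)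
  have hw₀' : (0 : ℝ) < w i₀ := hw₀
  have hm₀' : 0 < (m i₀).toReal := ENNReal.toReal_pos hm₀ (hm i₀)
  rw [ENNReal.toReal_div, ENNReal.toReal_sum fun i _ => hfin i]
  simp only [ENNReal.toReal_mul, ENNReal.coe_toReal]
  rw [← Finset.add_sum_erase _ _ (Finset.mem_univ i₀)]
  set S := ∑ i ∈ Finset.univ.erase i₀, (w i : ℝ) * (m i).toReal with hS
  have hS0 : 0 ≤ S := Finset.sum_nonneg fun i _ => by positivity
  have hw' : ∑ i ∈ Finset.univ.erase i₀, (w i : ℝ) ≤ 1 := by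
    have h1 : ∑ i, (w i : ℝ) = 1 := by exact_mod_cast hw
    rw [← Finset.add_sum_erase _ _ (Finset.mem_univ i₀)] at h1
    linarith
  have hS1 : S ≤ η * (m i₀).toReal := by
    calc S ≤ ∑ i ∈ Finset.univ.erase i₀, (w i : ℝ) * (η * (m i₀).toReal) :=
          Finset.sum_le_sum fun i hi =>
            mul_le_mul_of_nonneg_left (h i (Finset.ne_of_mem_erase hi)) (by positivity)
      _ = (∑ i ∈ Finset.univ.erase i₀, (w i : ℝ)) * (η * (m i₀).toReal) := by
          rw [Finset.sum_mul]
      _ ≤ 1 * (η * (m i₀).toReal) := mul_le_mul_of_nonneg_right hw' (by positivity)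
      _ = _ := one_mul _
  have hpos : 0 < (w i₀ : ℝ) * (m i₀).toReal := by positivity
  have e : (w i₀ : ℝ) * (m i₀).toReal / ((w i₀ : ℝ) * (m i₀).toReal + S) - 1 =
      -(S / ((w i₀ : ℝ) * (m i₀).toReal + S)) := by
    field_simp
    ring
  rw [e, abs_neg, abs_of_nonneg (by positivity), div_le_div_iff₀ (by linarith) hw₀']
  calc S * w i₀ ≤ η * (m i₀).toReal * w i₀ := mul_le_mul_of_nonneg_right hS1 hw₀'.le
    _ ≤ η * ((w i₀ : ℝ) * (m i₀).toReal + S) := by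
      have := mul_nonneg hη hS0
      linarith

end Comparison

/-! ### Marginal likelihoods and noise for a fixed sample size -/

section Consistency

variable {n p₀ p : ℕ} {X₀ : Matrix (Fin n) (Fin p₀) ℝ} {X : Matrix (Fin n) (Fin p) ℝ}

/-- The restricted maximum is at least the value at the lower bound, and at most the value of the
bound that holds for every admissible prior covariance matrix. -/
theorem modelMarginal_bounds (hind : LinearIndependent ℝ (Matrix.fromCols X₀ X).col)
    (horth : X₀ᵀ * X = 0) (hn : p₀ < n) {γ : Finset (Fin p)} {y : Fin n → ℝ}
    (hT : 0 < rss X₀ (modelDesign X γ) y) :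
    ENNReal.ofReal (evidenceConst X₀ * ((√((1 + (n : ℝ)) ^ γ.card))⁻¹ *
        (rss X₀ (modelDesign X γ) y + fitSq (modelDesign X γ) y / (1 + n)) ^
          (-(((n : ℝ) - p₀) / 2)))) ≤ modelMarginal X₀ X γ y ∧
      modelMarginal X₀ X γ y ≤ ENNReal.ofReal (evidenceConst X₀ *
        ((√((1 + (n : ℝ)) ^ γ.card))⁻¹ *
          rss X₀ (modelDesign X γ) y ^ (-(((n : ℝ) - p₀) / 2)))) := by
  have h₀ := posDef_gram_common hind
  have hG := posDef_gram_modelDesign hind γ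
  have ho := orth_modelDesign horth γ
  obtain ⟨h1, h2⟩ := typeIIMLCov_spec X₀ (modelDesign X γ) y
  have h3 := marginalLikelihood_le h₀ ho hG hn hT h1
  rw [marginalLikelihood_lowerBound h₀ ho hG hn hT] at h2
  rw [Fintype.card_coe] at h2 h3
  exact ⟨h2, h3⟩

variable {Ω : Type*} [MeasurableSpace Ω] {P : Measure Ω}
  {e : Ω → Fin n → ℝ} {σsq : ℝ≥0}

/-- A vanishing residual sum of squares would confine the data to a hyperplane orthogonal to a
nonzero row of the residual projection. -/
theorem ae_rss_pos (hind : LinearIndependent ℝ (Matrix.fromCols X₀ X).col)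
    (horth : X₀ᵀ * X = 0) (hn : p₀ + p < n) (hσ : 0 < σsq)
    (he : ∀ i, HasLaw (fun ω => e ω i) (gaussianReal 0 σsq) P)
    (hindep : iIndepFun (fun i ω => e ω i) P) (m : Fin n → ℝ) (γ : Finset (Fin p)) :
    ∀ᵐ ω ∂P, 0 < rss X₀ (modelDesign X γ) (m + e ω) := by
  have h₀ := posDef_gram_common hind
  have hG := posDef_gram_modelDesign hind γ
  have hcard : p₀ + Fintype.card γ < n := by
    have : Fintype.card γ ≤ p := by simpa using Finset.card_le_univ γ
    omega
  obtain ⟨i, hi⟩ := exists_row_ne_zero h₀ hG hcard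
  set H := 1 - proj X₀ - proj (modelDesign X γ) with hH
  filter_upwards [noise_linear_ne hσ he hindep hi (-(H i ⬝ᵥ m))] with ω hω
  rw [rss_eq_sq h₀ (orth_modelDesign horth γ) hG, ← hH]
  refine lt_of_le_of_ne (zero_le_dotProduct_self _) fun h => hω ?_
  have h1 := congrFun (dotProduct_self_eq_zero.mp h.symm) i
  change H i ⬝ᵥ (m + e ω) = 0 at h1
  rw [dotProduct_add] at h1
  linarith

/-- The sum of the squared projections of the noise on the common design and on all models. -/
noncomputable def totalFit (X₀ : Matrix (Fin n) (Fin p₀) ℝ) (X : Matrix (Fin n) (Fin p) ℝ)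
    (y : Fin n → ℝ) : ℝ :=
  fitSq X₀ y + ∑ γ : Finset (Fin p), fitSq (modelDesign X γ) y

theorem fitSq_add_fitSq_le_totalFit
    (hind : LinearIndependent ℝ (Matrix.fromCols X₀ X).col) (y : Fin n → ℝ)
    (γ : Finset (Fin p)) :
    fitSq X₀ y + fitSq (modelDesign X γ) y ≤ totalFit X₀ X y := by
  have := Finset.single_le_sum (f := fun γ : Finset (Fin p) => fitSq (modelDesign X γ) y)
    (fun γ _ => fitSq_nonneg (posDef_gram_modelDesign hind γ) y) (Finset.mem_univ γ)
  unfold totalFit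
  linarith

theorem totalFit_tail (hind : LinearIndependent ℝ (Matrix.fromCols X₀ X).col)
    (he : ∀ i, HasLaw (fun ω => e ω i) (gaussianReal 0 σsq) P)
    (hindep : iIndepFun (fun i ω => e ω i) P) {M : ℝ} (hM : 0 < M) :
    P.real {ω | M ≤ totalFit X₀ X (e ω)} ≤
      σsq * (p₀ + ∑ γ : Finset (Fin p), (γ.card : ℝ)) / M := by
  have h₀ := posDef_gram_common hind
  have i1 := noise_fitSq he hindep h₀
  have i2 := fun γ => noise_fitSq he hindep (posDef_gram_modelDesign hind γ)
  have hint : Integrable (fun ω => totalFit X₀ X (e ω)) P :=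
    i1.1.add (integrable_finsetSum _ fun γ _ => (i2 γ).1)
  have hval : ∫ ω, totalFit X₀ X (e ω) ∂P =
      σsq * (p₀ + ∑ γ : Finset (Fin p), (γ.card : ℝ)) := by
    unfold totalFit
    rw [integral_add i1.1 (integrable_finsetSum _ fun γ _ => (i2 γ).1), i1.2,
      integral_finsetSum _ fun γ _ => (i2 γ).1, Finset.sum_congr rfl fun γ _ => (i2 γ).2,
      ← Finset.mul_sum, Fintype.card_fin, mul_add]
    simp
  have h := mul_meas_ge_le_integral_of_nonneg (f := fun ω => totalFit X₀ X (e ω)) (μ := P)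
    (Eventually.of_forall fun ω => add_nonneg (fitSq_nonneg h₀ _)
      (Finset.sum_nonneg fun γ _ => fitSq_nonneg (posDef_gram_modelDesign hind γ) _)) hint M
  rw [hval] at h
  rw [le_div_iff₀ hM, mul_comm]
  exact h

/-- The lack of fit `μᵀ (1 - P_γ) μ` of the model `γ` when the model-specific mean is `μ`. -/
noncomputable def lackOfFit (X : Matrix (Fin n) (Fin p) ℝ) (μ : Fin n → ℝ) (γ : Finset (Fin p)) :
    ℝ :=
  μ ⬝ᵥ ((1 - proj (modelDesign X γ)) *ᵥ μ)

theorem lackOfFit_empty (X : Matrix (Fin n) (Fin p) ℝ) (μ : Fin n → ℝ) :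
    lackOfFit X μ ∅ = μ ⬝ᵥ μ := by
  have : proj (modelDesign X ∅) = 0 := by
    ext i j
    simp [proj, Matrix.mul_apply]
  rw [lackOfFit, this, sub_zero, Matrix.one_mulVec]

theorem fitSq_mean_le (hind : LinearIndependent ℝ (Matrix.fromCols X₀ X).col)
    (γ : Finset (Fin p)) (μ : Fin n → ℝ) : fitSq (modelDesign X γ) μ ≤ μ ⬝ᵥ μ := by
  have h1 := residual_sq_eq (posDef_gram_modelDesign hind γ) μ
  have h2 := zero_le_dotProduct_self ((1 - proj (modelDesign X γ)) *ᵥ μ)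
  rw [h1, Matrix.sub_mulVec, Matrix.one_mulVec, dotProduct_sub, ← fitSq_eq_proj] at h2
  linarith

end Consistency

/-! ### Consistency along a sequence of designs -/

section Sequences

variable {p₀ p : ℕ} {X₀ : ∀ n : ℕ, Matrix (Fin n) (Fin p₀) ℝ}
  {X : ∀ n : ℕ, Matrix (Fin n) (Fin p) ℝ}

/-- The empty model turns the separation assumption into a bound `|μ|² = O(n)`. -/
theorem exists_mean_sq_le {γs : Finset (Fin p)} (βs : γs → ℝ)
    (hdiff : ∀ γ : Finset (Fin p), ¬ γs ⊆ γ → ∃ b : ℝ, 0 < b ∧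
      Tendsto (fun n : ℕ => lackOfFit (X n) (modelDesign (X n) γs *ᵥ βs) γ / (n : ℝ))
        atTop (𝓝 b)) :
    ∃ B : ℝ, 0 ≤ B ∧ ∀ᶠ n : ℕ in atTop,
      (modelDesign (X n) γs *ᵥ βs) ⬝ᵥ (modelDesign (X n) γs *ᵥ βs) ≤ B * n := by
  by_cases h : γs ⊆ ∅
  · obtain rfl := Finset.subset_empty.mp h
    refine ⟨0, le_rfl, Eventually.of_forall fun n => ?_⟩
    have : modelDesign (X n) ∅ *ᵥ βs = 0 := by
      ext i
      simp [Matrix.mulVec, dotProduct]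
    simp [this]
  · obtain ⟨b, hb, hlim⟩ := hdiff ∅ h
    refine ⟨b + 1, by linarith, ?_⟩
    filter_upwards [hlim.eventually_le_const (lt_add_one b), eventually_gt_atTop 0] with n hn hn0
    have hn0' : (0 : ℝ) < n := by exact_mod_cast hn0
    rwa [lackOfFit_empty, div_le_iff₀ hn0'] at hn

/-- On the event that the noise behaves typically, every competing marginal likelihood is
eventually at most `η` times that of the true model. -/
theorem eventually_modelMarginal_le
    (hind : ∀ᶠ n in atTop, LinearIndependent ℝ (Matrix.fromCols (X₀ n) (X n)).col)
    (horth : ∀ᶠ n in atTop, (X₀ n)ᵀ * X n = 0) {γs : Finset (Fin p)} (βs : γs → ℝ)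
    {b : Finset (Fin p) → ℝ} (hb : ∀ γ, ¬ γs ⊆ γ → 0 < b γ ∧
      Tendsto (fun n : ℕ => lackOfFit (X n) (modelDesign (X n) γs *ᵥ βs) γ / (n : ℝ))
        atTop (𝓝 (b γ)))
    {s M η : ℝ} (hs : 0 < s) (hM : 0 ≤ M) (hη : 0 < η) :
    ∀ᶠ n : ℕ in atTop, ∀ (a : Fin p₀ → ℝ) (e : Fin n → ℝ),
      totalFit (X₀ n) (X n) e < M → |e ⬝ᵥ e - n * s| < n * (s / 2) →
      (∀ γ, ¬ γs ⊆ γ → |((1 - proj (modelDesign (X n) γ)) *ᵥ (modelDesign (X n) γs *ᵥ βs)) ⬝ᵥ e| <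
        n * (b γ / 16)) →
      (modelMarginal (X₀ n) (X n) γs (X₀ n *ᵥ a + (modelDesign (X n) γs *ᵥ βs + e)) ≠ 0) ∧
      ∀ γ, (modelMarginal (X₀ n) (X n) γ
          (X₀ n *ᵥ a + (modelDesign (X n) γs *ᵥ βs + e)) ≠ ∞) ∧
        (γ ≠ γs → (modelMarginal (X₀ n) (X n) γ
          (X₀ n *ᵥ a + (modelDesign (X n) γs *ᵥ βs + e))).toReal ≤
            η * (modelMarginal (X₀ n) (X n) γs
              (X₀ n *ᵥ a + (modelDesign (X n) γs *ᵥ βs + e))).toReal) := by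
  obtain ⟨B, hB, hBn⟩ := exists_mean_sq_le βs fun γ hγ => ⟨b γ, hb γ hγ⟩
  have hlim : Tendsto (fun n : ℕ => (n : ℝ)) atTop atTop := tendsto_natCast_atTop_atTop
  have hC : 0 ≤ 2 * B + 2 * M := by positivity
  have hnest := eventually_evidence_le_of_nested p₀ (half_pos hs) hM hC hη
  have hfar : ∀ᶠ n : ℕ in atTop, ∀ γ, ¬ γs ⊆ γ →
      (n : ℝ) * (b γ / 2) ≤ lackOfFit (X n) (modelDesign (X n) γs *ᵥ βs) γ ∧
      M ≤ n * (b γ / 8) ∧ ∀ (k l : ℕ) (Q T N : ℝ), l ≤ p → 0 ≤ Q → Q ≤ (2 * s) * n →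
      Q + b γ / 4 * n ≤ T → 0 < N → N ≤ Q + (2 * B + 2 * M) →
      0 < T ∧ (√((1 + (n : ℝ)) ^ k))⁻¹ * T ^ (-(((n : ℝ) - p₀) / 2)) ≤
        η * ((√((1 + (n : ℝ)) ^ l))⁻¹ * N ^ (-(((n : ℝ) - p₀) / 2))) := by
    rw [eventually_all]
    intro γ
    by_cases hγ : γs ⊆ γ
    · exact Eventually.of_forall fun n h => absurd hγ h
    obtain ⟨hb0, hbl⟩ := hb γ hγ
    filter_upwards [hbl.eventually_const_le (half_lt_self hb0), eventually_gt_atTop 0,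
      hlim.eventually_ge_atTop (M / (b γ / 8)),
      eventually_evidence_le_of_not_nested p₀ p (b := b γ / 4) (D := 2 * s)
        (C := 2 * B + 2 * M) (by positivity) (by positivity) hη] with n h1 h2 h3 h4 _
    have hn0 : (0 : ℝ) < n := by exact_mod_cast h2
    rw [le_div_iff₀ hn0] at h1
    rw [div_le_iff₀ (by positivity)] at h3
    exact ⟨by linarith, h3, h4⟩
  filter_upwards [hind, horth, eventually_gt_atTop p₀, hBn, hnest, hfar,
    hlim.eventually_gt_atTop (M / (s / 2))]
    with n hi ho hn hBn hnest hfar hMs a e hfit hQ hcross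
  have hn0 : (0 : ℝ) < n := by exact_mod_cast (by omega : 0 < n)
  set μ := modelDesign (X n) γs *ᵥ βs with hμ
  set y := X₀ n *ᵥ a + (μ + e) with hy
  have h₀ := posDef_gram_common hi
  have hG := posDef_gram_modelDesign hi
  have hK := evidenceConst_pos h₀ hn
  obtain ⟨hQ1, hQ2⟩ := abs_lt.mp hQ
  have hQ0 : 0 ≤ e ⬝ᵥ e := zero_le_dotProduct_self e
  rw [div_lt_iff₀ (by positivity)] at hMs
  have hrss : ∀ γ, rss (X₀ n) (modelDesign (X n) γ) y = lackOfFit (X n) μ γ +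
      2 * (((1 - proj (modelDesign (X n) γ)) *ᵥ μ) ⬝ᵥ e) + e ⬝ᵥ e -
      fitSq (X₀ n) e - fitSq (modelDesign (X n) γ) e := fun γ => by
    rw [hy, rss_add_common h₀ (orth_modelDesign ho γ) (hG γ),
      rss_add_eq (common_transpose_mulVec_mean ho γs βs), lackOfFit]
  have hfits : ∀ γ, fitSq (X₀ n) e + fitSq (modelDesign (X n) γ) e < M := fun γ =>
    (fitSq_add_fitSq_le_totalFit hi e γ).trans_lt hfit
  have hf0 : 0 ≤ fitSq (X₀ n) e := fitSq_nonneg h₀ e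
  have hf : ∀ γ, 0 ≤ fitSq (modelDesign (X n) γ) e := fun γ => fitSq_nonneg (hG γ) e
  -- Models that nest the true one have no lack of fit and no cross term.
  have hsub : ∀ γ, γs ⊆ γ → rss (X₀ n) (modelDesign (X n) γ) y = e ⬝ᵥ e -
      fitSq (X₀ n) e - fitSq (modelDesign (X n) γ) e := fun γ hγ => by
    rw [hrss, lackOfFit, hμ, residual_modelDesign_eq_zero hγ (hG γ)]
    simp
  have hTs : 0 < rss (X₀ n) (modelDesign (X n) γs) y := by
    rw [hsub γs subset_rfl]
    linarith [hfits γs]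
  set N := rss (X₀ n) (modelDesign (X n) γs) y + fitSq (modelDesign (X n) γs) y / (1 + n) with hN
  have hNpos : 0 < N := by
    have := fitSq_nonneg (hG γs) y
    positivity
  -- `fitSq` is of order `n` for the true model, and the factor `1 / (1 + n)` makes it bounded.
  have hNle : N ≤ e ⬝ᵥ e + (2 * B + 2 * M) := by
    have h1 : fitSq (modelDesign (X n) γs) y ≤ 2 * (B * n) + 2 * M := by
      rw [hy, fitSq_add_common (orth_modelDesign ho γs)]
      refine (fitSq_add_le (hG γs) μ e).trans ?_
      linarith [fitSq_mean_le hi γs μ, hfits γs]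
    have h2 : fitSq (modelDesign (X n) γs) y / (1 + n) ≤ 2 * B + 2 * M := by
      rw [div_le_iff₀ (by positivity)]
      have := mul_nonneg hM hn0.le
      linarith
    have h3 := hsub γs subset_rfl
    linarith [hf γs]
  have hmain : ∀ γ, γ ≠ γs → 0 < rss (X₀ n) (modelDesign (X n) γ) y ∧
      (√((1 + (n : ℝ)) ^ γ.card))⁻¹ *
        rss (X₀ n) (modelDesign (X n) γ) y ^ (-(((n : ℝ) - p₀) / 2)) ≤
      η * ((√((1 + (n : ℝ)) ^ γs.card))⁻¹ * N ^ (-(((n : ℝ) - p₀) / 2))) := by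
    intro γ hγ
    by_cases hγs : γs ⊆ γ
    · refine hnest _ _ (e ⬝ᵥ e) _ _
        (Finset.card_lt_card (lt_of_le_of_ne hγs (Ne.symm hγ))) (by linarith) ?_ hNpos hNle
      rw [hsub γ hγs]
      linarith [hfits γ]
    · obtain ⟨h1, h2, h3⟩ := hfar γ hγs
      obtain ⟨h4, h5⟩ := abs_lt.mp (hcross γ hγs)
      refine h3 _ _ (e ⬝ᵥ e) _ _ (by simpa using Finset.card_le_univ γs) hQ0 (by linarith) ?_
        hNpos hNle
      rw [hrss]
      linarith [hfits γ]
  have hpos : ∀ γ, 0 < rss (X₀ n) (modelDesign (X n) γ) y := fun γ => by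
    by_cases h : γ = γs
    · rw [h]
      exact hTs
    · exact (hmain γ h).1
  have hbd := fun γ => modelMarginal_bounds hi ho hn (hpos γ)
  have hlow := (hbd γs).1
  rw [← hN] at hlow
  have hne0 : modelMarginal (X₀ n) (X n) γs y ≠ 0 := by
    refine (lt_of_lt_of_le (ENNReal.ofReal_pos.mpr ?_) hlow).ne'
    positivity
  have htop : ∀ γ, modelMarginal (X₀ n) (X n) γ y ≠ ∞ := fun γ =>
    ne_top_of_le_ne_top ENNReal.ofReal_ne_top (hbd γ).2
  refine ⟨hne0, fun γ => ⟨htop γ, fun hγ => ?_⟩⟩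
  have h1 := ENNReal.toReal_mono ENNReal.ofReal_ne_top (hbd γ).2
  have h2 := ENNReal.toReal_mono (htop γs) hlow
  rw [ENNReal.toReal_ofReal (mul_nonneg hK.le (mul_nonneg (by positivity)
    (Real.rpow_nonneg (hpos γ).le _)))] at h1
  rw [ENNReal.toReal_ofReal (by positivity)] at h2
  refine h1.trans ((mul_le_mul_of_nonneg_left (hmain γ hγ).2 hK.le).trans ?_)
  rw [mul_left_comm]
  exact mul_le_mul_of_nonneg_left h2 hη.le

theorem tendsto_div_mul_sq {f : ℕ → ℝ} {L : ℝ}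
    (hf : Tendsto (fun n => f n / (n : ℝ)) atTop (𝓝 L)) (t : ℝ) :
    Tendsto (fun n : ℕ => f n / (n * t) ^ 2) atTop (𝓝 0) := by
  have hinv : Tendsto (fun n : ℕ => ((n : ℝ))⁻¹) atTop (𝓝 0) :=
    tendsto_inv_atTop_zero.comp tendsto_natCast_atTop_atTop
  have h := (hf.mul hinv).mul_const ((t ^ 2)⁻¹)
  rw [mul_zero, zero_mul] at h
  refine h.congr fun n => ?_
  rw [mul_pow, div_eq_mul_inv, div_eq_mul_inv, mul_inv]
  ring

variable {Ω : Type*} [MeasurableSpace Ω] {P : Measure Ω} [IsProbabilityMeasure P]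
  {e : ∀ n : ℕ, Ω → Fin n → ℝ} {σsq : ℝ≥0}

/-- The noise behaves atypically with a probability of at most `δ` for large `n`, when the
threshold `M` for the projections is large enough. -/
theorem exists_eventually_atypical_le
    (hind : ∀ᶠ n in atTop, LinearIndependent ℝ (Matrix.fromCols (X₀ n) (X n)).col)
    {γs : Finset (Fin p)} (βs : γs → ℝ)
    {b : Finset (Fin p) → ℝ} (hb : ∀ γ, ¬ γs ⊆ γ → 0 < b γ ∧
      Tendsto (fun n : ℕ => lackOfFit (X n) (modelDesign (X n) γs *ᵥ βs) γ / (n : ℝ))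
        atTop (𝓝 (b γ)))
    (hσ : 0 < σsq) (he : ∀ n i, HasLaw (fun ω => e n ω i) (gaussianReal 0 σsq) P)
    (hindep : ∀ n, iIndepFun (fun i ω => e n ω i) P) {δ : ℝ} (hδ : 0 < δ) :
    ∃ M : ℝ, 0 < M ∧ ∀ᶠ n : ℕ in atTop, P.real {ω |
      ¬ (totalFit (X₀ n) (X n) (e n ω) < M ∧
        |e n ω ⬝ᵥ e n ω - n * σsq| < n * ((σsq : ℝ) / 2) ∧
        ∀ γ, ¬ γs ⊆ γ →
          |((1 - proj (modelDesign (X n) γ)) *ᵥ (modelDesign (X n) γs *ᵥ βs)) ⬝ᵥ e n ω| <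
            n * (b γ / 16))} < δ := by
  have hσ' : (0 : ℝ) < σsq := hσ
  -- `c` is the mean of `totalFit`, so Markov's inequality bounds its tail at `M` by `c / M < δ / 2`.
  set c : ℝ := σsq * (p₀ + ∑ γ : Finset (Fin p), (γ.card : ℝ)) with hc
  have hc0 : 0 ≤ c := mul_nonneg hσ'.le
    (add_nonneg (Nat.cast_nonneg _) (Finset.sum_nonneg fun _ _ => Nat.cast_nonneg _))
  set M := (c + 1) / (δ / 2) with hM
  have hMpos : 0 < M := div_pos (by linarith) (half_pos hδ)
  have hcM : c / M < δ / 2 := by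
    rw [hM, div_div_eq_mul_div, div_lt_iff₀ (by linarith)]
    have : 0 < δ / 2 := half_pos hδ
    linarith
  set V := Var[fun x => x ^ 2; gaussianReal 0 σsq] with hV
  -- the two remaining error terms are of order `1 / n`
  have hV0 : Tendsto (fun n : ℕ => n * V / (n * ((σsq : ℝ) / 2)) ^ 2) atTop (𝓝 0) := by
    refine tendsto_div_mul_sq (L := V) (tendsto_const_nhds.congr' ?_) _
    filter_upwards [eventually_gt_atTop 0] with n hn
    rw [mul_div_cancel_left₀ _ (Nat.cast_ne_zero.mpr hn.ne')]
  have hcr : ∀ γ, ¬ γs ⊆ γ → Tendsto (fun n : ℕ =>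
      σsq * lackOfFit (X n) (modelDesign (X n) γs *ᵥ βs) γ / (n * (b γ / 16)) ^ 2)
      atTop (𝓝 0) := fun γ hγ => by
    refine tendsto_div_mul_sq (L := σsq * b γ) ?_ _
    simp only [mul_div_assoc]
    exact (hb γ hγ).2.const_mul _
  have hlim : Tendsto (fun n : ℕ => n * V / (n * ((σsq : ℝ) / 2)) ^ 2 +
      ∑ γ ∈ Finset.univ.filter (fun γ => ¬ γs ⊆ γ),
        σsq * lackOfFit (X n) (modelDesign (X n) γs *ᵥ βs) γ / (n * (b γ / 16)) ^ 2)
      atTop (𝓝 0) := by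
    have h := hV0.add (tendsto_finsetSum (Finset.univ.filter (fun γ => ¬ γs ⊆ γ))
      fun γ hγ => hcr γ (Finset.mem_filter.mp hγ).2)
    simpa using h
  refine ⟨M, hMpos, ?_⟩
  filter_upwards [hind, hlim.eventually_lt_const (half_pos hδ), eventually_gt_atTop 0]
    with n hi hsmall hn
  have hn0 : (0 : ℝ) < n := by exact_mod_cast hn
  have hsubset : {ω | ¬ (totalFit (X₀ n) (X n) (e n ω) < M ∧
        |e n ω ⬝ᵥ e n ω - n * σsq| < n * ((σsq : ℝ) / 2) ∧
        ∀ γ, ¬ γs ⊆ γ →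
          |((1 - proj (modelDesign (X n) γ)) *ᵥ (modelDesign (X n) γs *ᵥ βs)) ⬝ᵥ e n ω| <
            n * (b γ / 16))} ⊆
      {ω | M ≤ totalFit (X₀ n) (X n) (e n ω)} ∪
      ({ω | n * ((σsq : ℝ) / 2) ≤ |e n ω ⬝ᵥ e n ω - n * σsq|} ∪
      ⋃ γ ∈ Finset.univ.filter (fun γ => ¬ γs ⊆ γ), {ω | n * (b γ / 16) ≤
        |((1 - proj (modelDesign (X n) γ)) *ᵥ (modelDesign (X n) γs *ᵥ βs)) ⬝ᵥ e n ω|}) := by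
    intro ω hω
    by_contra hcon
    simp only [Set.mem_union, Set.mem_iUnion, not_or, not_exists, Finset.mem_filter,
      Finset.mem_univ, true_and] at hcon
    obtain ⟨h1, h2, h3⟩ := hcon
    exact hω ⟨not_le.mp h1, not_le.mp h2, fun γ hγ => not_le.mp (h3 γ hγ)⟩
  refine (measureReal_mono hsubset).trans_lt ?_
  refine (measureReal_union_le _ _).trans_lt ?_
  have hu := measureReal_union_le (μ := P)
    {ω | n * ((σsq : ℝ) / 2) ≤ |e n ω ⬝ᵥ e n ω - n * σsq|}
    (⋃ γ ∈ Finset.univ.filter (fun γ => ¬ γs ⊆ γ), {ω | n * (b γ / 16) ≤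
        |((1 - proj (modelDesign (X n) γ)) *ᵥ (modelDesign (X n) γs *ᵥ βs)) ⬝ᵥ e n ω|})
  have h1 := totalFit_tail hi (he n) (hindep n) hMpos
  have h2 := noise_sq_tail (he n) (hindep n) (t := n * ((σsq : ℝ) / 2)) (by positivity)
  have h3 := measureReal_biUnion_finset_le (μ := P) (Finset.univ.filter (fun γ => ¬ γs ⊆ γ))
    (fun γ => {ω | n * (b γ / 16) ≤
        |((1 - proj (modelDesign (X n) γ)) *ᵥ (modelDesign (X n) γs *ᵥ βs)) ⬝ᵥ e n ω|})
  have h4 : ∑ γ ∈ Finset.univ.filter (fun γ => ¬ γs ⊆ γ), P.real {ω | n * (b γ / 16) ≤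
        |((1 - proj (modelDesign (X n) γ)) *ᵥ (modelDesign (X n) γs *ᵥ βs)) ⬝ᵥ e n ω|} ≤
      ∑ γ ∈ Finset.univ.filter (fun γ => ¬ γs ⊆ γ),
        σsq * lackOfFit (X n) (modelDesign (X n) γs *ᵥ βs) γ / (n * (b γ / 16)) ^ 2 := by
    refine Finset.sum_le_sum fun γ hγ => ?_
    have hb0 := (hb γ (Finset.mem_filter.mp hγ).2).1
    have := noise_linear_tail (he n) (hindep n)
      ((1 - proj (modelDesign (X n) γ)) *ᵥ (modelDesign (X n) γs *ᵥ βs))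
      (t := n * (b γ / 16)) (by positivity)
    rwa [residual_sq_eq (posDef_gram_modelDesign hi γ)] at this
  linarith

end Sequences

end TypeIIML

theorem mainTheorem4 {p₀ p : ℕ}
    -- common and model-specific design matrices at each sample size
    (X₀ : ∀ n : ℕ, Matrix (Fin n) (Fin p₀) ℝ) (X : ∀ n : ℕ, Matrix (Fin n) (Fin p) ℝ)
    (hind : ∀ᶠ n in atTop, LinearIndependent ℝ (Matrix.fromCols (X₀ n) (X n)).col)
    (horth : ∀ᶠ n in atTop, (X₀ n)ᵀ * X n = 0)
    -- prior probabilities of the models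
    (prior : Finset (Fin p) → ℝ≥0) (hprior : ∑ γ, prior γ = 1)
    -- the true model, which has positive prior probability, and its parameters
    (γs : Finset (Fin p)) (hγs : 0 < prior γs)
    (β₀ : ℕ → Fin p₀ → ℝ) (βs : γs → ℝ) (σsq : ℝ≥0) (hσ : 0 < σsq)
    -- the data: `Y n ∼ N(X₀ β₀ + X_* β_*, σ² I)`
    {Ω : Type*} [MeasurableSpace Ω] (P : Measure Ω) [IsProbabilityMeasure P]
    (Y : ∀ n : ℕ, Ω → Fin n → ℝ)
    (hlaw : ∀ (n : ℕ) (i : Fin n), HasLaw (fun ω => Y n ω i)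
      (gaussianReal ((X₀ n *ᵥ β₀ n + TypeIIML.modelDesign (X n) γs *ᵥ βs) i) σsq) P)
    (hindep : ∀ n : ℕ, iIndepFun (fun (i : Fin n) ω => Y n ω i) P)
    -- models that do not nest the true model can be differentiated in the limit
    (hdiff : ∀ γ : Finset (Fin p), ¬ γs ⊆ γ → ∃ b : ℝ, 0 < b ∧
      Tendsto (fun n : ℕ =>
        ((TypeIIML.modelDesign (X n) γs *ᵥ βs) ⬝ᵥ
          ((1 - TypeIIML.proj (TypeIIML.modelDesign (X n) γ)) *ᵥ
            (TypeIIML.modelDesign (X n) γs *ᵥ βs))) / (n : ℝ)) atTop (𝓝 b)) :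
    -- the type II ML priors are almost surely well defined for large `n`, and
    -- the posterior probability of the true model tends to one in probability
    (∀ᶠ n in atTop, ∀ᵐ ω ∂P, ∀ γ : Finset (Fin p), ∃ W,
      TypeIIML.IsTypeIIMLCov (X₀ n) (TypeIIML.modelDesign (X n) γ) (Y n ω) W) ∧
    TendstoInMeasure P
      (fun n ω => TypeIIML.posteriorProb prior (X₀ n) (X n) γs (Y n ω))
      atTop (fun _ => 1) := by
  -- The noise is centred at each sample size, so that only `Y n = X₀ β₀ + X_* β_* + e n` is used.
  set e : ∀ n : ℕ, Ω → Fin n → ℝ := fun n ω i =>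
    Y n ω i - (X₀ n *ᵥ β₀ n + TypeIIML.modelDesign (X n) γs *ᵥ βs) i with he_def
  have he : ∀ n i, HasLaw (fun ω => e n ω i) (gaussianReal 0 σsq) P := by
    intro n i
    have := gaussianReal_sub_const (hlaw n i)
      ((X₀ n *ᵥ β₀ n + TypeIIML.modelDesign (X n) γs *ᵥ βs) i)
    rwa [sub_self] at this
  have heind : ∀ n, iIndepFun (fun i ω => e n ω i) P := fun n =>
    (hindep n).comp (fun i x => x - (X₀ n *ᵥ β₀ n + TypeIIML.modelDesign (X n) γs *ᵥ βs) i)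
      fun i => by fun_prop
  have hY : ∀ n ω, Y n ω = (X₀ n *ᵥ β₀ n + TypeIIML.modelDesign (X n) γs *ᵥ βs) + e n ω := by
    intro n ω
    ext i
    simp [he_def]
  constructor
  · filter_upwards [hind, horth, eventually_gt_atTop (p₀ + p)] with n hi ho hn
    rw [ae_all_iff]
    intro γ
    filter_upwards [TypeIIML.ae_rss_pos hi ho hn hσ (he n) (heind n)
      (X₀ n *ᵥ β₀ n + TypeIIML.modelDesign (X n) γs *ᵥ βs) γ] with ω hω
    rw [← hY] at hω
    exact TypeIIML.exists_isTypeIIMLCov (TypeIIML.posDef_gram_common hi)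
      (TypeIIML.orth_modelDesign ho γ) (TypeIIML.posDef_gram_modelDesign hi γ) (by omega) hω
  · choose! b hb using hdiff
    rw [tendstoInMeasure_iff_measureReal_norm]
    intro ε hε
    have hw : (0 : ℝ) < prior γs := hγs
    -- Evidence ratios of at most `ε / 2 * prior γs` put the posterior within `ε / 2` of one.
    have hη : 0 < ε / 2 * prior γs := by positivity
    refine tendsto_order.mpr ⟨fun a ha => Eventually.of_forall fun n =>
      ha.trans_le measureReal_nonneg, fun δ hδ => ?_⟩
    obtain ⟨M, hM, hbad⟩ := TypeIIML.exists_eventually_atypical_le hind βs hb hσ he heind hδ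
    filter_upwards [hbad, TypeIIML.eventually_modelMarginal_le hind horth βs hb
      (NNReal.coe_pos.mpr hσ) hM.le hη] with n hbad hgood
    refine (measureReal_mono fun ω hω => ?_).trans_lt hbad
    rintro ⟨h1, h2, h3⟩
    obtain ⟨hne, hall⟩ := hgood (β₀ n) (e n ω) h1 h2 h3
    rw [← add_assoc, ← hY] at hne
    simp only [← add_assoc, ← hY] at hall
    have hpost := TypeIIML.abs_posterior_sub_one_le hprior hγs hne (fun γ => (hall γ).1)
      hη.le fun γ hγ => (hall γ).2 hγ
    rw [mul_div_cancel_right₀ _ hw.ne'] at hpost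
    have hω' : ε ≤ |TypeIIML.posteriorProb prior (X₀ n) (X n) γs (Y n ω) - 1| := hω
    have : |TypeIIML.posteriorProb prior (X₀ n) (X n) γs (Y n ω) - 1| ≤ ε / 2 := hpost
    linarith
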